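/- **Setting.** Let $d\ge 1$, and for $x\in\mathbb R^d$, $L>0$ let $\Lambda_L(x)=x+(-\frac L2,\frac L2)^d$. Let $u$ be a measurable function on $\mathbb R^d$ with $u_-\chi_{\Lambda_{\delta_-}(0)}\le u\le u_+\chi_{\Lambda_{\delta_+}(0)}$ almost everywhere, for some constants $u_\pm,\delta_\pm\in(0,\infty)$. Let $(\mathbf Y,\varepsilon_{\mathbf Y})$ be a marked Poisson process on $\mathbb R^d$: $\mathbf Y$ is a Poisson process with density $2\varrho$ whose points carry independent fair marks in $\{0,1\}$ (that is, the marked points form a Poisson process on $\mathbb R^d\times\{0,1\}$ with density $2\varrho$ with respect to $|\tilde A|=\frac12(|\{x:(x,0)\in\tilde A\}|+|\{x:(x,1)\in\tilde A\}|)$). Let $\mathbf X$ and $\mathbf X'$ be the sets of points with mark $1$ and $0$; $\mathbf X$ is the Poisson process with density $\varrho$ of the Poisson Hamiltonian $H_{\mathbf X}=-\Delta+\sum_{\zeta\in\mathbf X}u(\cdot-\zeta)$. Write $N_Z(A)=\#(Z\cap A)$. Fix numbers $\alpha,\beta\in(0,1)$, $\gamma>d\beta$ and $\kappa>0$. **Good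 boxes.** For disjoint finite configurations $B,S$ and $t_S\in[0,1]^S$, and $\Lambda=\Lambda_L(x)$, let $H_{B,(S,t_S),\Lambda}=-\Delta_\Lambda+\sum_{\zeta\in B\cap\Lambda}u(\cdot-\zeta)+\sum_{\zeta\in S\cap\Lambda}t_\zeta u(\cdot-\zeta)$ on $L^2(\Lambda)$, with Dirichlet boundary condition. The box $\Lambda$ is $(B,S,E,m)$-good if $B\cap S=\emptyset$ and, for all $t_S\in[0,1]^S$, the resolvent $R=(H_{B,(S,t_S),\Lambda}-E)^{-1}$ exists as a bounded operator, $\|R\|\le e^{L^{1-\alpha}}$, and $\|\chi_yR\chi_{y'}\|\le e^{-m|y-y'|}$ for all $y,y'\in\Lambda$ with $|y-y'|\ge\frac L{10}$, where $\chi_y=\chi_{\Lambda_1(y)}$. **Basic events.** Let $\eta_L=e^{-L^{10^6d}}$ and $\mathbb J_\Lambda=\{j\in x+\eta_L\mathbb Z^d:\Lambda_{\eta_L}(j)\subset\Lambda\}$ for $\Lambda=\Lambda_L(x)$. A countable set $Z\subset\mathbb R^d$ is $\Lambda$-acceptable if $N_Z(\Lambda)<16\varrho L^d$, $N_Z(\Lambda_{\eta_L}(j))\le1$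 for all $j\in\mathbb J_\Lambda$, and $N_Z(\Lambda\setminus\bigcup_{j\in\mathbb J_\Lambda}\Lambda_{\eta_L(1-\eta_L)}(j))=0$. For $J\subset\mathbb J_\Lambda$ let $[J]_\Lambda$ be the set of acceptable $Z$ with $N_Z(\Lambda_{\eta_L}(j))=N_J(\Lambda_{\eta_L}(j))$ for all $j\in\mathbb J_\Lambda$, and let $C_{\Lambda,B,S}=\bigcup_{S'\subset S}[B\cup S']_\Lambda$. For pairwise disjoint $B,B',S\subset\mathbb J_\Lambda$ with $\#(B\cup B'\cup S)<16\varrho L^d$, the basic event is $$\mathcal C_{\Lambda,B,B',S}=\{\mathbf Y\in[B\cup B'\cup S]_\Lambda\}\cap\{\mathbf X\in C_{\Lambda,B,S}\}\cap\{\mathbf X'\in C_{\Lambda,B',S}\}.$$ It is $(\Lambda,E,m)$-adapted if $\Lambda$ is $(B,S,E,m)$-good and $\#(S\cap\Lambda_{L^{1-\beta}-\delta_+}(y))\ge L^{d-\gamma}$ for every box $\Lambda_{L^{1-\beta}}(y)\subset\Lambda$. For $p>0$, the scale $L$ is $(E,m)$-localizing if for every box $\Lambda$ of side $L$ there is an event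 $\Omega_\Lambda$, a finite disjoint union of $(\Lambda,E,m)$-adapted basic events, with $\mathbb P(\Omega_\Lambda)>1-L^{-p}$. **Proposition 4.1.** There is a constant $C_u>0$, depending only on $d$ and $u$ (with $u_\pm,\delta_\pm$), such that for every density $\varrho>0$ and every $p>0$ (and all $\alpha,\beta,\gamma,\kappa$ as above) there is a finite scale $\overline L_0$, depending only on $d,u,\varrho,p$ and $\alpha,\beta,\gamma,\kappa$, such that for all $L\ge\overline L_0$ we have $L^{-\kappa}\le\varrho\le e^{L^d}$ and, setting $$\delta_L=1+\bigl((p+d+1)\varrho^{-1}\log L\bigr)^{1/d},\qquad E_L=C_u\,\delta_L^{-2(d+1)},\qquad m_L=\tfrac12\sqrt{E_L},$$ the scale $L$ is $(E,m_L)$-localizing for all energies $E\in[0,E_L]$. -/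

import Mathlib

open MeasureTheory ProbabilityTheory Set Filter
open scoped ENNReal

namespace PoissonHam

/-- Euclidean space `ℝ^d`. -/
abbrev E (d : ℕ) : Type := EuclideanSpace ℝ (Fin d)

/-- The open box of side `L` centred at `x`. -/
def box {d : ℕ} (x : E d) (L : ℝ) : Set (E d) := {y | ∀ i, |y i - x i| < L / 2}

theorem measurableSet_box {d : ℕ} (x : E d) (L : ℝ) : MeasurableSet (box x L) := by
  have h : box x L = ⋂ i, {y : E d | |y i - x i| < L / 2} := by
    ext y
    simp [box]
  rw [h]
  refine MeasurableSet.iInter fun i => ?_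
  exact (isOpen_lt (by fun_prop) continuous_const).measurableSet

/-- The number of points of the configuration `X` in the set `A`. -/
noncomputable def count {S : Type*} (X A : Set S) : ℕ∞ := (X ∩ A).encard

/-! ### Single-site potentials -/

/-- A single-site potential: a (class of a) measurable function `u` on `ℝ^d` squeezed between
multiples of characteristic functions of two boxes centred at the origin.  In particular it is
nonnegative, nonzero, bounded and compactly supported (up to null sets). -/
structure SingleSite (d : ℕ) where
  u : E d → ℝ
  uMinus : ℝ
  uPlus : ℝ
  deltaMinus : ℝ
  deltaPlus : ℝ
  aemeasurable : AEMeasurable u volume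
  uMinus_pos : 0 < uMinus
  uPlus_pos : 0 < uPlus
  deltaMinus_pos : 0 < deltaMinus
  deltaPlus_pos : 0 < deltaPlus
  lower : ∀ᵐ y ∂(volume : Measure (E d)), (box 0 deltaMinus).indicator (fun _ => uMinus) y ≤ u y
  upper : ∀ᵐ y ∂(volume : Measure (E d)), u y ≤ (box 0 deltaPlus).indicator (fun _ => uPlus) y

/-! ### Poisson processes -/

/-- `Z` is a Poisson process with intensity measure `ν`. -/
structure IsPoissonProcess {Ω S : Type*} [MeasurableSpace Ω] [MeasurableSpace S]
    (Z : Ω → Set S) (ν : Measure S) (P : Measure Ω) : Prop where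
  countable : ∀ ω, (Z ω).Countable
  measurable : ∀ A : Set S, MeasurableSet A → Measurable fun ω => count (Z ω) A
  law : ∀ A : Set S, MeasurableSet A → ν A < ∞ → ∀ k : ℕ,
    P {ω | count (Z ω) A = (k : ℕ∞)} =
      ENNReal.ofReal ((ν A).toReal ^ k / (k.factorial : ℝ) * Real.exp (-(ν A).toReal))
  indep : ∀ (n : ℕ) (A : Fin n → Set S), (∀ i, MeasurableSet (A i)) →
    Pairwise (fun i j => Disjoint (A i) (A j)) →
    iIndepFun (fun i ω => count (Z ω) (A i)) P

/-- The measure `½ (|{x : (x,0) ∈ A}| + |{x : (x,1) ∈ A}|)` on `ℝ^d × {0,1}`. -/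
noncomputable def markedVolume (d : ℕ) : Measure (E d × Bool) :=
  (volume : Measure (E d)).prod ((2⁻¹ : ℝ≥0∞) • Measure.count)

/-- A marked Poisson process `(Y, ε_Y)` whose points have density `2ϱ`: a random configuration `Y`
with a mark `ε_ζ ∈ {0,1}` at each of its points `ζ`, such that the marked points form a Poisson
process on `ℝ^d × {0,1}` with density `2ϱ` (equivalently, the marks of the Poisson process `Y` are
independent fair Bernoulli variables).  Only the values of `mark ω` on `Y ω` matter. -/
structure MarkedPoissonProcess (d : ℕ) (ϱ : ℝ) {Ω : Type*} [MeasurableSpace Ω]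
    (P : Measure Ω) where
  Y : Ω → Set (E d)
  mark : Ω → E d → Bool
  isPoisson : IsPoissonProcess (fun ω => {q : E d × Bool | q.1 ∈ Y ω ∧ q.2 = mark ω q.1})
    (ENNReal.ofReal (2 * ϱ) • markedVolume d) P

namespace MarkedPoissonProcess

variable {d : ℕ} {ϱ : ℝ} {Ω : Type*} [MeasurableSpace Ω] {P : Measure Ω}

/-- The points with mark `1`: the Poisson process of density `ϱ` that defines the Poisson
Hamiltonian. -/
def X (M : MarkedPoissonProcess d ϱ P) (ω : Ω) : Set (E d) := {ζ | ζ ∈ M.Y ω ∧ M.mark ω ζ = true}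

/-- The points with mark `0`. -/
def X' (M : MarkedPoissonProcess d ϱ P) (ω : Ω) : Set (E d) := {ζ | ζ ∈ M.Y ω ∧ M.mark ω ζ = false}

end MarkedPoissonProcess

/-! ### Finite volume operators

Unbounded operators on `L²(Λ)` are given by their graphs. -/

/-- The complex Hilbert space `L²(Λ)`. -/
abbrev L2 {d : ℕ} (Λ : Set (E d)) : Type := Lp ℂ 2 ((volume : Measure (E d)).restrict Λ)

/-- The graph of the gradient on `C_c^∞(Λ)`, as an operator from `L²(Λ)` to `L²(Λ)^d`. -/
def testGradient {d : ℕ} (Λ : Set (E d)) : Set (L2 Λ × (Fin d → L2 Λ)) :=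
  {p | ∃ ψ : E d → ℂ, ContDiff ℝ (⊤ : ℕ∞) ψ ∧ HasCompactSupport ψ ∧ tsupport ψ ⊆ Λ ∧
    p.1 =ᵐ[volume.restrict Λ] ψ ∧
    ∀ i, p.2 i =ᵐ[volume.restrict Λ] fun y => fderiv ℝ ψ y (EuclideanSpace.single i 1)}

/-- The graph of the gradient `∇_Λ` with Dirichlet boundary condition (with domain `H_0^1(Λ)`): the
closure of the gradient on `C_c^∞(Λ)`. -/
def dirichletGradient {d : ℕ} (Λ : Set (E d)) : Set (L2 Λ × (Fin d → L2 Λ)) :=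
  closure (testGradient Λ)

/-- The graph of `-Δ_Λ = ∇_Λ^* ∇_Λ`, the Dirichlet Laplacian. -/
def negDirichletLaplacian {d : ℕ} (Λ : Set (E d)) : Set (L2 Λ × L2 Λ) :=
  {p | ∃ G : Fin d → L2 Λ, (p.1, G) ∈ dirichletGradient Λ ∧
    ∀ q ∈ dirichletGradient Λ, ∑ i, inner ℂ (q.2 i) (G i) = inner ℂ q.1 p.2}

/-- The graph of `-Δ_Λ + V` for a bounded potential `V`, with the domain of `-Δ_Λ`. -/
def schrodinger {d : ℕ} (Λ : Set (E d)) (V : E d → ℝ) : Set (L2 Λ × L2 Λ) :=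
  {p | ∃ g : L2 Λ, (p.1, g) ∈ negDirichletLaplacian Λ ∧
    p.2 =ᵐ[volume.restrict Λ] fun y => g y + (V y : ℂ) * p.1 y}

/-- `R` is the (everywhere defined, bounded) inverse `(H - z)⁻¹` of the operator with graph `H`
minus `z`: `(H - z) φ = f` if and only if `φ = R f`. -/
def IsResolvent {d : ℕ} {Λ : Set (E d)} (H : Set (L2 Λ × L2 Λ)) (z : ℂ)
    (R : L2 Λ →L[ℂ] L2 Λ) : Prop :=
  ∀ φ f : L2 Λ, (φ, f + z • φ) ∈ H ↔ φ = R f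

/-- The potential `V_{X,(Y,t_Y),Λ}`, with the impurities in `Λ` only:
`∑_{ζ ∈ X ∩ Λ} u(y - ζ) + ∑_{ζ ∈ Y ∩ Λ} t_ζ u(y - ζ)`. It is only used when `X ∩ Λ` and
`Y ∩ Λ` are finite. -/
noncomputable def potential {d : ℕ} (u : SingleSite d) (Λ X Y : Set (E d)) (t : E d → ℝ)
    (y : E d) : ℝ :=
  ∑' ζ : ↥(X ∩ Λ), u.u (y - ζ) + ∑' ζ : ↥(Y ∩ Λ), t ζ * u.u (y - ζ)

/-- Multiplication by the characteristic function `χ_x` of the unit box centred at `x`, on elements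
of `L²(Λ)`. -/
noncomputable def chiFun {d : ℕ} (Λ : Set (E d)) (x : E d) (f : L2 Λ) : L2 Λ :=
  MemLp.toLp ((box x 1).indicator (f : E d → ℂ)) ((Lp.memLp f).indicator (measurableSet_box x 1))

theorem chiFun_coe {d : ℕ} (Λ : Set (E d)) (x : E d) (f : L2 Λ) :
    (chiFun Λ x f : E d → ℂ) =ᵐ[volume.restrict Λ] (box x 1).indicator (f : E d → ℂ) :=
  MemLp.coeFn_toLp _

theorem chiFun_add {d : ℕ} (Λ : Set (E d)) (x : E d) (f g : L2 Λ) :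
    chiFun Λ x (f + g) = chiFun Λ x f + chiFun Λ x g := by
  refine Lp.ext ?_
  filter_upwards [chiFun_coe Λ x f, chiFun_coe Λ x g, chiFun_coe Λ x (f + g),
    Lp.coeFn_add f g, Lp.coeFn_add (chiFun Λ x f) (chiFun Λ x g)] with y h1 h2 h3 h4 h5
  rw [h3, h5, Pi.add_apply, h1, h2]
  by_cases hy : y ∈ box x 1
  · rw [indicator_of_mem hy, indicator_of_mem hy, indicator_of_mem hy, h4, Pi.add_apply]
  · rw [indicator_of_notMem hy, indicator_of_notMem hy, indicator_of_notMem hy, add_zero]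

theorem chiFun_smul {d : ℕ} (Λ : Set (E d)) (x : E d) (c : ℂ) (f : L2 Λ) :
    chiFun Λ x (c • f) = c • chiFun Λ x f := by
  refine Lp.ext ?_
  filter_upwards [chiFun_coe Λ x f, chiFun_coe Λ x (c • f),
    Lp.coeFn_smul c f, Lp.coeFn_smul c (chiFun Λ x f)] with y h1 h3 h4 h5
  rw [h3, h5, Pi.smul_apply, h1]
  by_cases hy : y ∈ box x 1 <;> simp [hy, h4]

theorem norm_chiFun_le {d : ℕ} (Λ : Set (E d)) (x : E d) (f : L2 Λ) :
    ‖chiFun Λ x f‖ ≤ 1 * ‖f‖ := by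
  rw [one_mul]
  refine Lp.norm_le_norm_of_ae_le ?_
  filter_upwards [chiFun_coe Λ x f] with y h1
  rw [h1]
  exact norm_indicator_le_norm_self _ _

/-- The bounded operator of multiplication by `χ_x` on `L²(Λ)`. -/
noncomputable def chi {d : ℕ} (Λ : Set (E d)) (x : E d) : L2 Λ →L[ℂ] L2 Λ :=
  LinearMap.mkContinuous
    { toFun := chiFun Λ x
      map_add' := chiFun_add Λ x
      map_smul' := chiFun_smul Λ x }
    1 (norm_chiFun_le Λ x)

/-- The box `Λ_L(x)` is `(X, Y, Eₙ, m)`-good, where `α > 0` is the small number in the exponent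
`L^{1-} = L^{1-α}`: `X` and `Y` are disjoint, and for every choice of `t_Y ∈ [0,1]^Y` the
resolvent at the energy `Eₙ` exists, has norm at most `exp (L^{1-α})`, and decays exponentially with
rate `m`. -/
def IsGoodBox {d : ℕ} (u : SingleSite d) (α : ℝ) (x : E d) (L : ℝ) (X Y : Set (E d))
    (Eₙ m : ℝ) : Prop :=
  Disjoint X Y ∧ ∀ t : E d → ℝ, (∀ ζ ∈ Y, t ζ ∈ Icc (0 : ℝ) 1) →
    ∃ R : L2 (box x L) →L[ℂ] L2 (box x L),
      IsResolvent (schrodinger (box x L) (potential u (box x L) X Y t)) (Eₙ : ℂ) R ∧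
      ‖R‖ ≤ Real.exp (L ^ (1 - α)) ∧
      ∀ y ∈ box x L, ∀ y' ∈ box x L, L / 10 ≤ ‖y - y'‖ →
        ‖(chi (box x L) y).comp (R.comp (chi (box x L) y'))‖ ≤ Real.exp (-m * ‖y - y'‖)

/-! ### Finite volume reduction of configurations -/

/-- `η_L = exp (-L^{10⁶ d})`. -/
noncomputable def eta (d : ℕ) (L : ℝ) : ℝ := Real.exp (-L ^ (10 ^ 6 * d))

/-- The points `j` of `x + η_L ℤ^d` whose box of side `η_L` is contained in `Λ_L(x)`. -/
def lattice {d : ℕ} (x : E d) (L : ℝ) : Set (E d) :=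
  {j | (∃ k : Fin d → ℤ, ∀ i, j i = x i + eta d L * k i) ∧ box j (eta d L) ⊆ box x L}

/-- The set of `Λ_L(x)`-acceptable configurations. -/
def acceptable {d : ℕ} (ϱ : ℝ) (x : E d) (L : ℝ) : Set (Set (E d)) :=
  {Z | Z.Countable ∧
    (count Z (box x L) : ℝ≥0∞) < ENNReal.ofReal (16 * ϱ * L ^ d) ∧
    (∀ j ∈ lattice x L, count Z (box j (eta d L)) ≤ 1) ∧
    count Z (box x L \ ⋃ j ∈ lattice x L, box j (eta d L * (1 - eta d L))) = 0}

/-- The subsets of the lattice with fewer than `16 ϱ L^d` points. -/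
def latticeConfigs {d : ℕ} (ϱ : ℝ) (x : E d) (L : ℝ) : Set (Set (E d)) :=
  {J | J ⊆ lattice x L ∧ (J.encard : ℝ≥0∞) < ENNReal.ofReal (16 * ϱ * L ^ d)}

/-- The acceptable configurations that are equivalent to `J`, i.e. have the same number of points as
`J` in each box of side `η_L` centred at a lattice point. -/
def eqClass {d : ℕ} (ϱ : ℝ) (x : E d) (L : ℝ) (J : Set (E d)) : Set (Set (E d)) :=
  {Z | Z ∈ acceptable ϱ x L ∧
    ∀ j ∈ lattice x L, count Z (box j (eta d L)) = count J (box j (eta d L))}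

/-- The basic configuration set `C_{Λ,B,S} = ⋃_{S' ⊆ S} [B ∪ S']`. -/
def bconfset {d : ℕ} (ϱ : ℝ) (x : E d) (L : ℝ) (B S : Set (E d)) : Set (Set (E d)) :=
  ⋃ S' ∈ 𝒫 S, eqClass ϱ x L (B ∪ S')

/-- `B`, `B'`, `S` are admissible labels of a basic event: they are pairwise disjoint, and their
union is a set of fewer than `16 ϱ L^d` lattice points. -/
def IsLabel {d : ℕ} (ϱ : ℝ) (x : E d) (L : ℝ) (B B' S : Set (E d)) : Prop :=
  Disjoint B B' ∧ Disjoint B S ∧ Disjoint B' S ∧ B ∪ B' ∪ S ∈ latticeConfigs ϱ x L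

/-- The basic event with labels `B`, `B'`, `S`. -/
def bevent {d : ℕ} {ϱ : ℝ} {Ω : Type*} [MeasurableSpace Ω] {P : Measure Ω}
    (M : MarkedPoissonProcess d ϱ P) (x : E d) (L : ℝ) (B B' S : Set (E d)) : Set Ω :=
  {ω | M.Y ω ∈ eqClass ϱ x L (B ∪ B' ∪ S) ∧ M.X ω ∈ bconfset ϱ x L B S ∧
    M.X' ω ∈ bconfset ϱ x L B' S}

/-- The density condition: every box of side `ℓ = L^{1-β}` contained in `Λ_L(x)` has, in the
concentric box of side `ℓ - δ₊`, at least `L^{d-γ}` points of `S`. -/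
def IsDense {d : ℕ} (u : SingleSite d) (β γ : ℝ) (x : E d) (L : ℝ) (S : Set (E d)) : Prop :=
  ∀ y : E d, box y (L ^ (1 - β)) ⊆ box x L →
    ENNReal.ofReal (L ^ ((d : ℝ) - γ)) ≤ (count S (box y (L ^ (1 - β) - u.deltaPlus)) : ℝ≥0∞)

/-- The basic event with labels `B`, `B'`, `S` is `(Λ_L(x), Eₙ, m)`-adapted, i.e. good and dense. -/
def IsAdapted {d : ℕ} (ϱ : ℝ) (u : SingleSite d) (α β γ : ℝ) (x : E d) (L Eₙ m : ℝ)
    (B B' S : Set (E d)) : Prop :=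
  IsLabel ϱ x L B B' S ∧ IsGoodBox u α x L B S Eₙ m ∧ IsDense u β γ x L S

/-- `A` is a `(Λ_L(x), Eₙ, m)`-localized event: a finite disjoint union of adapted basic events. -/
def IsLocalizedEvent {d : ℕ} {ϱ : ℝ} {Ω : Type*} [MeasurableSpace Ω] {P : Measure Ω}
    (M : MarkedPoissonProcess d ϱ P) (u : SingleSite d) (α β γ : ℝ) (x : E d) (L Eₙ m : ℝ)
    (A : Set Ω) : Prop :=
  ∃ (I : ℕ) (B B' S : Fin I → Set (E d)),
    (∀ i, IsAdapted ϱ u α β γ x L Eₙ m (B i) (B' i) (S i)) ∧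
    Pairwise (fun i j => Disjoint (bevent M x L (B i) (B' i) (S i))
      (bevent M x L (B j) (B' j) (S j))) ∧
    A = ⋃ i, bevent M x L (B i) (B' i) (S i)

/-- The scale `L` is `(Eₙ, m)`-localizing: every box of side `L` has a localized event of probability
larger than `1 - L^{-p}`. -/
def IsLocalizingScale {d : ℕ} {ϱ : ℝ} {Ω : Type*} [MeasurableSpace Ω] {P : Measure Ω}
    (M : MarkedPoissonProcess d ϱ P) (u : SingleSite d) (α β γ p Eₙ m L : ℝ) : Prop :=
  ∀ x : E d, ∃ A : Set Ω, IsLocalizedEvent M u α β γ x L Eₙ m A ∧ 1 - L ^ (-p) < P.real A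

/-! ### The scale-dependent quantities of the initial estimate -/

/-- `δ_L = 1 + ((p + d + 1) ϱ⁻¹ log L)^{1/d}`. -/
noncomputable def deltaScale (d : ℕ) (ϱ p L : ℝ) : ℝ :=
  1 + ((p + d + 1) * ϱ⁻¹ * Real.log L) ^ (1 / (d : ℝ))

/-- `E_L = C δ_L^{-2(d+1)}`. -/
noncomputable def energyScale (d : ℕ) (C ϱ p L : ℝ) : ℝ :=
  C * deltaScale d ϱ p L ^ (-(2 * ((d : ℝ) + 1)))

/-- `m_L = √E_L / 2`. -/
noncomputable def rateScale (d : ℕ) (C ϱ p L : ℝ) : ℝ :=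
  1 / 2 * Real.sqrt (energyScale d C ϱ p L)

end PoissonHam

/-!
The free sites are put into a region fixed in advance. Divide `Λ_L` into cells of side `l = δ_L`. A
cell has an inner box of volume `(p + d + 1) ϱ⁻¹ log L`, so it contains no point of `X` with
probability `L^{-(p+d+1)}` only, and outside of an event of probability `O(L^{-p-1})` every cell
contains a point of `X`. The points of `Y` in the cells with only odd indices are declared free
(`S`), the other ones keep their marks (`B` and `B'`). Each cell of odd indices contains a free
site, and a box of side `L^{1-β}` contains `L^{d(1-β)}` of them up to logarithms, hence more than
`L^{d-γ}` (`le_count_label_inter`). Each cell of even indices contains a point of `B`, so `B` is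
relatively dense at the scale `4 l` (`label_diff_relDense`). Since `S` is the part of the label in a
fixed region, a configuration determines the triple `(B, B', S)`, and the basic events that occur are
disjoint (`eq_of_mem_bevent`). That `Y` is acceptable with probability close to one follows from a
Chernoff bound and from the smallness of `η_L` (`prob_bad_le`).

The free sites only add a nonnegative potential, so goodness of the box follows from the relative
density of `B`, uniformly in `t_S`. Translating by a vector `v` changes `φ ∈ H_0^1(Λ)` in `L²` by at
most `|v| ‖∇φ‖`; about `l^d` translates of `⋃_{ζ ∈ B} Λ_{δ₋}(ζ)` by vectors of length `O(l)` cover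
`Λ`, whence `‖φ‖² ≤ K l^{d+2} (‖∇φ‖² + ⟨φ, V φ⟩)` (`lintegral_sq_le_of_cover`,
`formBound_of_relDense`). As `d + 2 ≤ 2 (d + 1)`, the constant `C = 1 / (4 K)` makes the operator at
least `4 E_L`. The resolvent at an energy `E ≤ E_L` then exists by the Lax–Milgram argument
(`exists_solutionOp`), and conjugation with the weight `exp (a · z)`, `‖a‖ = √E_L`, lowers the form
by at most `E_L` (`norm_conj_le`). This gives decay at the rate `√E_L = 2 m_L`, and half of the rate
absorbs the prefactors at distances of at least `L / 10`.
-/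

namespace PoissonHam

/-! ### Translations of smooth functions -/

/-- `|∇ψ(x)|²`, with values in `[0, ∞]`. -/
noncomputable def gradSq {d : ℕ} (ψ : E d → ℂ) (x : E d) : ℝ≥0∞ :=
  ∑ i, ‖fderiv ℝ ψ x (EuclideanSpace.single i 1)‖ₑ ^ 2

theorem enorm_fderiv_sq_le {d : ℕ} (ψ : E d → ℂ) (x v : E d) :
    ‖fderiv ℝ ψ x v‖ₑ ^ 2 ≤ ‖v‖ₑ ^ 2 * gradSq ψ x := by
  have hv : fderiv ℝ ψ x v = ∑ i, v i • fderiv ℝ ψ x (EuclideanSpace.single i 1) := by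
    have h : v = ∑ i, v i • EuclideanSpace.single i (1 : ℝ) := by
      ext j
      simp [Pi.single_apply]
    conv_lhs => rw [h]
    rw [map_sum]
    exact Finset.sum_congr rfl fun i _ => map_smul _ _ _
  have h1 : ‖fderiv ℝ ψ x v‖ ^ 2 ≤
      ‖v‖ ^ 2 * ∑ i, ‖fderiv ℝ ψ x (EuclideanSpace.single i 1)‖ ^ 2 := by
    have h2 : ‖fderiv ℝ ψ x v‖ ≤
        ∑ i, |v i| * ‖fderiv ℝ ψ x (EuclideanSpace.single i 1)‖ := by
      rw [hv]
      refine (norm_sum_le _ _).trans (Finset.sum_le_sum fun i _ => ?_)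
      rw [norm_smul, Real.norm_eq_abs]
    calc _ ≤ (∑ i, |v i| * ‖fderiv ℝ ψ x (EuclideanSpace.single i 1)‖) ^ 2 := by gcongr
      _ ≤ (∑ i, |v i| ^ 2) * _ := Finset.sum_mul_sq_le_sq_mul_sq _ _ _
      _ = _ := by simp [EuclideanSpace.norm_sq_eq]
  have h3 : ∀ r : ℂ, ‖r‖ₑ ^ 2 = ENNReal.ofReal (‖r‖ ^ 2) := fun r => by
    rw [ENNReal.ofReal_pow (norm_nonneg _), ofReal_norm]
  have h4 : ‖v‖ₑ ^ 2 = ENNReal.ofReal (‖v‖ ^ 2) := by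
    rw [ENNReal.ofReal_pow (norm_nonneg _), ofReal_norm]
  rw [gradSq, h3, h4]
  simp_rw [h3]
  rw [← ENNReal.ofReal_sum_of_nonneg (fun i _ => by positivity),
    ← ENNReal.ofReal_mul (by positivity)]
  exact ENNReal.ofReal_le_ofReal h1

theorem measurable_gradSq {d : ℕ} {ψ : E d → ℂ} (hψ : ContDiff ℝ (⊤ : ℕ∞) ψ) :
    Measurable (gradSq ψ) := by
  have h : Continuous (fderiv ℝ ψ) := hψ.continuous_fderiv (by simp)
  refine Finset.measurable_sum _ fun i _ => ?_
  have : Continuous fun x => fderiv ℝ ψ x (EuclideanSpace.single i 1) := by fun_prop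
  exact this.measurable.enorm.pow_const 2

theorem enorm_sub_translate_sq_le {d : ℕ} {ψ : E d → ℂ} (hψ : ContDiff ℝ (⊤ : ℕ∞) ψ) (x v : E d) :
    ‖ψ (x + v) - ψ x‖ₑ ^ 2 ≤
      ‖v‖ₑ ^ 2 * ∫⁻ s in Ioc (0 : ℝ) 1, gradSq ψ (x + s • v) := by
  have hc : Continuous (fderiv ℝ ψ) := hψ.continuous_fderiv (by simp)
  have hc' : Continuous fun s : ℝ => fderiv ℝ ψ (x + s • v) v := by fun_prop
  have h1 : ψ (x + v) - ψ x = ∫ s in (0 : ℝ)..1, fderiv ℝ ψ (x + s • v) v := by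
    have := intervalIntegral.integral_eq_sub_of_hasDerivAt (a := 0) (b := 1)
      (f := fun s : ℝ => ψ (x + s • v)) (f' := fun s => fderiv ℝ ψ (x + s • v) v)
      (fun s _ => by
        have h2 : HasDerivAt (fun s : ℝ => x + s • v) v s := by
          simpa using ((hasDerivAt_id s).smul_const v).const_add x
        exact ((hψ.differentiable (by simp)).differentiableAt.hasFDerivAt).comp_hasDerivAt s h2)
      (hc'.intervalIntegrable _ _)
    rw [this]
    simp
  rw [h1, intervalIntegral.integral_of_le zero_le_one]
  have h2 := enorm_integral_le_lintegral_enorm (μ := volume.restrict (Ioc (0 : ℝ) 1))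
    (fun s => fderiv ℝ ψ (x + s • v) v)
  have : IsProbabilityMeasure (volume.restrict (Ioc (0 : ℝ) 1)) := ⟨by simp⟩
  have h3 := eLpNorm_le_eLpNorm_of_exponent_le (μ := volume.restrict (Ioc (0 : ℝ) 1))
    (p := 1) (q := 2) (by norm_num) (hc'.aestronglyMeasurable)
  rw [eLpNorm_one_eq_lintegral_enorm] at h3
  calc _ ≤ (eLpNorm (fun s : ℝ => fderiv ℝ ψ (x + s • v) v) 2
        (volume.restrict (Ioc (0 : ℝ) 1))) ^ 2 := by gcongr; exact h2.trans h3
    _ = ∫⁻ s in Ioc (0 : ℝ) 1, ‖fderiv ℝ ψ (x + s • v) v‖ₑ ^ 2 := by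
        have := eLpNorm_nnreal_pow_eq_lintegral (f := fun s : ℝ => fderiv ℝ ψ (x + s • v) v)
          (μ := volume.restrict (Ioc (0 : ℝ) 1)) (p := 2) (by norm_num)
        simpa using this
    _ ≤ ∫⁻ s in Ioc (0 : ℝ) 1, ‖v‖ₑ ^ 2 * gradSq ψ (x + s • v) :=
        lintegral_mono fun s => enorm_fderiv_sq_le ψ _ v
    _ = _ := by
        rw [lintegral_const_mul]
        exact (measurable_gradSq hψ).comp (by fun_prop)

/-- The `L²` modulus of continuity of a smooth function is controlled by its Dirichlet energy. -/
theorem lintegral_sub_translate_sq_le {d : ℕ} {ψ : E d → ℂ} (hψ : ContDiff ℝ (⊤ : ℕ∞) ψ) (v : E d) :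
    ∫⁻ x, ‖ψ (x + v) - ψ x‖ₑ ^ 2 ≤ ‖v‖ₑ ^ 2 * ∫⁻ x, gradSq ψ x := by
  calc _ ≤ ∫⁻ x, ‖v‖ₑ ^ 2 * ∫⁻ s in Ioc (0 : ℝ) 1, gradSq ψ (x + s • v) :=
        lintegral_mono fun x => enorm_sub_translate_sq_le hψ x v
    _ = ‖v‖ₑ ^ 2 * ∫⁻ x, ∫⁻ s in Ioc (0 : ℝ) 1, gradSq ψ (x + s • v) := by
        rw [lintegral_const_mul' _ _ (by simp)]
    _ = ‖v‖ₑ ^ 2 * ∫⁻ s in Ioc (0 : ℝ) 1, ∫⁻ x, gradSq ψ (x + s • v) := by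
        rw [lintegral_lintegral_swap]
        exact ((measurable_gradSq hψ).comp (by fun_prop)).aemeasurable
    _ = _ := by
        simp_rw [lintegral_add_right_eq_self (gradSq ψ)]
        simp

/-- If finitely many translates of `W` by vectors of length at most `R` cover the support of `ψ`,
the mass of `ψ` is controlled by its mass on `W` and its Dirichlet energy. -/
theorem lintegral_sq_le_of_cover {d : ℕ} {ψ : E d → ℂ} (hψ : ContDiff ℝ (⊤ : ℕ∞) ψ)
    {Λ W : Set (E d)} (hW : MeasurableSet W) (hs : Function.support ψ ⊆ Λ)
    (T : Finset (E d)) (R : ℝ) (hT : ∀ v ∈ T, ‖v‖ ≤ R)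
    (hcov : ∀ y ∈ Λ, ∃ v ∈ T, y - v ∈ W) :
    ∫⁻ x, ‖ψ x‖ₑ ^ 2 ≤ (T.card : ℝ≥0∞) *
      (2 * (∫⁻ x in W, ‖ψ x‖ₑ ^ 2) + 2 * ENNReal.ofReal (R ^ 2) * ∫⁻ x, gradSq ψ x) := by
  have hm : Measurable fun x => ‖ψ x‖ₑ ^ 2 := hψ.continuous.measurable.enorm.pow_const 2
  have h1 : ∀ v ∈ T, ∫⁻ x in {x | x - v ∈ W}, ‖ψ x‖ₑ ^ 2 ≤
      2 * (∫⁻ x in W, ‖ψ x‖ₑ ^ 2) + 2 * ENNReal.ofReal (R ^ 2) * ∫⁻ x, gradSq ψ x := by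
    intro v hv
    have hv2 : ‖v‖ₑ ^ 2 ≤ ENNReal.ofReal (R ^ 2) := by
      rw [← ofReal_norm, ← ENNReal.ofReal_pow (norm_nonneg _)]
      gcongr
      exact hT v hv
    have hW' : MeasurableSet {x | x - v ∈ W} := hW.preimage (by fun_prop)
    calc ∫⁻ x in {x | x - v ∈ W}, ‖ψ x‖ₑ ^ 2
        = ∫⁻ x, ({x | x - v ∈ W}).indicator (fun x => ‖ψ x‖ₑ ^ 2) x := by
          rw [lintegral_indicator hW']
      _ = ∫⁻ x, ({x | x - v ∈ W}).indicator (fun x => ‖ψ x‖ₑ ^ 2) (x + v) :=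
          (lintegral_add_right_eq_self _ v).symm
      _ = ∫⁻ x, W.indicator (fun x => ‖ψ (x + v)‖ₑ ^ 2) x := by
          refine lintegral_congr fun x => ?_
          by_cases hx : x ∈ W <;> simp [indicator, hx]
      _ = ∫⁻ x in W, ‖ψ (x + v)‖ₑ ^ 2 := lintegral_indicator hW _
      _ ≤ ∫⁻ x in W, (2 * ‖ψ x‖ₑ ^ 2 + 2 * ‖ψ (x + v) - ψ x‖ₑ ^ 2) := by
          refine lintegral_mono fun x => ?_
          have h2 : ‖ψ (x + v)‖ₑ ≤ ‖ψ x‖ₑ + ‖ψ (x + v) - ψ x‖ₑ := by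
            have := enorm_add_le (ψ x) (ψ (x + v) - ψ x)
            simpa using this
          have h3 : (‖ψ x‖ₑ + ‖ψ (x + v) - ψ x‖ₑ) ^ 2 ≤
              2 * ‖ψ x‖ₑ ^ 2 + 2 * ‖ψ (x + v) - ψ x‖ₑ ^ 2 := by
            have := ENNReal.rpow_add_le_mul_rpow_add_rpow ‖ψ x‖ₑ ‖ψ (x + v) - ψ x‖ₑ
              (p := 2) (by norm_num)
            norm_num at this
            rwa [mul_add] at this
          exact (pow_le_pow_left' h2 2).trans h3
      _ = 2 * (∫⁻ x in W, ‖ψ x‖ₑ ^ 2) + 2 * ∫⁻ x in W, ‖ψ (x + v) - ψ x‖ₑ ^ 2 := by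
          rw [lintegral_add_left (hm.const_mul 2), lintegral_const_mul _ hm,
            lintegral_const_mul' _ _ (by simp)]
      _ ≤ 2 * (∫⁻ x in W, ‖ψ x‖ₑ ^ 2) + 2 * (ENNReal.ofReal (R ^ 2) * ∫⁻ x, gradSq ψ x) := by
          gcongr
          exact (setLIntegral_le_lintegral _ _).trans
            ((lintegral_sub_translate_sq_le hψ v).trans (by gcongr))
      _ = _ := by rw [mul_assoc]
  calc ∫⁻ x, ‖ψ x‖ₑ ^ 2 = ∫⁻ x in ⋃ v ∈ T, {x | x - v ∈ W}, ‖ψ x‖ₑ ^ 2 := by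
        symm
        apply setLIntegral_eq_of_support_subset
        intro x hx
        have : x ∈ Function.support ψ := by
          intro h0; apply hx; simp [h0]
        obtain ⟨v, hv, hw⟩ := hcov x (hs this)
        exact mem_biUnion hv hw
    _ ≤ ∑ v ∈ T, ∫⁻ x in {x | x - v ∈ W}, ‖ψ x‖ₑ ^ 2 := by
        have hU : (⋃ v ∈ T, {x | x - v ∈ W}) = ⋃ v : T, {x | x - (v : E d) ∈ W} := by
          ext x
          simp
        rw [← Finset.tsum_subtype, hU]
        exact lintegral_iUnion_le (fun v : T => {x | x - (v : E d) ∈ W}) _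
    _ ≤ ∑ _v ∈ T, _ := Finset.sum_le_sum h1
    _ = _ := by rw [Finset.sum_const, nsmul_eq_mul]

end PoissonHam

namespace PoissonHam

/-! ### Multiplication operators on `L²` -/

section MulOp

variable {α : Type*} [MeasurableSpace α] {μ : Measure α}

/-- Multiplication by a bounded function on `L²`. -/
noncomputable def mulOp {w : α → ℂ} (hw : MemLp w ∞ μ) : Lp ℂ 2 μ →L[ℂ] Lp ℂ 2 μ :=
  (ContinuousLinearMap.mul ℂ ℂ).holderL μ ∞ 2 2 (hw.toLp w)

theorem mulOp_coe {w : α → ℂ} (hw : MemLp w ∞ μ) (f : Lp ℂ 2 μ) :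
    mulOp hw f =ᵐ[μ] fun y => w y * f y := by
  have h := (ContinuousLinearMap.mul ℂ ℂ).coeFn_holder (r := 2) (hw.toLp w) f
  filter_upwards [h, hw.coeFn_toLp] with y h1 h2
  rw [← h2]
  exact h1

theorem inner_eq_integral (f g : Lp ℂ 2 μ) :
    inner ℂ f g = ∫ y, (starRingEnd ℂ) (f y) * g y ∂μ := by
  rw [L2.inner_def]
  refine integral_congr_ae (Eventually.of_forall fun y => ?_)
  simp [mul_comm]

theorem enorm_sq_eq_lintegral (f : Lp ℂ 2 μ) : ‖f‖ₑ ^ 2 = ∫⁻ y, ‖f y‖ₑ ^ 2 ∂μ := by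
  have := eLpNorm_nnreal_pow_eq_lintegral (f := f) (μ := μ) (p := 2) (by norm_num)
  rw [Lp.enorm_def]
  simpa using this

theorem integrable_norm_sq (f : Lp ℂ 2 μ) : Integrable (fun y => ‖f y‖ ^ 2) μ :=
  (Lp.memLp f).integrable_norm_pow (by norm_num)

/-- Multiplication by a real function is symmetric. -/
theorem inner_mulOp_left {w : α → ℝ} (hw : MemLp (fun y => (w y : ℂ)) ∞ μ) (f g : Lp ℂ 2 μ) :
    inner ℂ (mulOp hw f) g = inner ℂ f (mulOp hw g) := by
  rw [inner_eq_integral, inner_eq_integral]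
  refine integral_congr_ae ?_
  filter_upwards [mulOp_coe hw f, mulOp_coe hw g] with y h1 h2
  rw [h1, h2, map_mul, Complex.conj_ofReal]
  ring

theorem re_inner_mulOp_self {w : α → ℝ} (hw : MemLp (fun y => (w y : ℂ)) ∞ μ) (f : Lp ℂ 2 μ) :
    (inner ℂ f (mulOp hw f)).re = ∫ y, w y * ‖f y‖ ^ 2 ∂μ := by
  rw [inner_eq_integral]
  have : ∫ y, (starRingEnd ℂ) (f y) * (mulOp hw f) y ∂μ = ∫ y, ((w y * ‖f y‖ ^ 2 : ℝ) : ℂ) ∂μ := by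
    refine integral_congr_ae ?_
    filter_upwards [mulOp_coe hw f] with y h1
    have := Complex.mul_conj (f y)
    rw [Complex.normSq_eq_norm_sq] at this
    rw [h1]
    push_cast at this ⊢
    rw [← this]
    ring
  rw [this, integral_complex_ofReal, Complex.ofReal_re]

theorem integrable_mul_norm_sq {w : α → ℝ} (hw : MemLp (fun y => (w y : ℂ)) ∞ μ) (f : Lp ℂ 2 μ) :
    Integrable (fun y => w y * ‖f y‖ ^ 2) μ := by
  have h1 := (integrable_norm_sq f)
  have hw' : MemLp w ∞ μ := by simpa using hw.re
  exact h1.mul_of_top_right hw'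

end MulOp

theorem re_inner_mulOp_mono {α : Type*} [MeasurableSpace α] {μ : Measure α} {v w : α → ℝ}
    (hv : MemLp (fun y => (v y : ℂ)) ∞ μ) (hw : MemLp (fun y => (w y : ℂ)) ∞ μ)
    (h : ∀ᵐ y ∂μ, v y ≤ w y) (f : Lp ℂ 2 μ) :
    (inner ℂ f (mulOp hv f)).re ≤ (inner ℂ f (mulOp hw f)).re := by
  rw [re_inner_mulOp_self, re_inner_mulOp_self]
  refine integral_mono_ae (integrable_mul_norm_sq hv f) (integrable_mul_norm_sq hw f) ?_
  filter_upwards [h] with y hy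
  gcongr

theorem memLp_indicator_one {α : Type*} [MeasurableSpace α] {μ : Measure α} {W : Set α}
    (hW : MeasurableSet W) : MemLp (fun y => ((W.indicator (fun _ => (1 : ℝ)) y : ℝ) : ℂ)) ∞ μ := by
  refine memLp_top_of_bound ?_ 1 (Eventually.of_forall fun y => ?_)
  · exact (Complex.measurable_ofReal.comp (measurable_const.indicator hW)).aestronglyMeasurable
  · by_cases hy : y ∈ W <;> simp [hy]

/-! ### The Dirichlet gradient -/

variable {d : ℕ} {Λ : Set (E d)}

/-- The test functions and their gradients form a subspace. -/
def testSubmodule (Λ : Set (E d)) : Submodule ℂ (L2 Λ × (Fin d → L2 Λ)) where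
  carrier := testGradient Λ
  add_mem' := by
    rintro ⟨f, F⟩ ⟨g, G⟩ ⟨ψ, h1, h2, h3, h4, h5⟩ ⟨χ, k1, k2, k3, k4, k5⟩
    refine ⟨ψ + χ, h1.add k1, h2.add k2, (tsupport_add ψ χ).trans (union_subset h3 k3), ?_, ?_⟩
    · filter_upwards [h4, k4, Lp.coeFn_add f g] with y a1 a2 a3
      simp_all
    · intro i
      filter_upwards [h5 i, k5 i, Lp.coeFn_add (F i) (G i)] with y a1 a2 a3
      rw [fderiv_add (h1.differentiable (by simp)).differentiableAt
        (k1.differentiable (by simp)).differentiableAt]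
      simp_all
  zero_mem' := by
    refine ⟨0, contDiff_const, HasCompactSupport.zero, by simp, ?_, fun i => ?_⟩
    · exact Lp.coeFn_zero _ _ _
    · filter_upwards [Lp.coeFn_zero ℂ 2 (volume.restrict Λ)] with y hy
      have : fderiv ℝ (0 : E d → ℂ) y = 0 := by
        simp
      rw [this]
      simpa using hy
  smul_mem' := by
    rintro c ⟨f, F⟩ ⟨ψ, h1, h2, h3, h4, h5⟩
    refine ⟨c • ψ, h1.const_smul c, h2.smul_left (f := fun _ => c), 
      (closure_mono (Function.support_const_smul_subset c ψ)).trans h3, ?_, ?_⟩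
    · filter_upwards [h4, Lp.coeFn_smul c f] with y a1 a2
      simp_all
    · intro i
      filter_upwards [h5 i, Lp.coeFn_smul c (F i)] with y a1 a2
      rw [fderiv_const_smul (h1.differentiable (by simp)).differentiableAt]
      simp_all

theorem setLIntegral_eq_of_ae_eq {g h : E d → ℝ≥0∞} (hs : ∀ x, x ∉ Λ → g x = 0)
    (hae : h =ᵐ[volume.restrict Λ] g) : ∫⁻ x in Λ, h x = ∫⁻ x, g x :=
  (lintegral_congr_ae hae).trans
    (setLIntegral_eq_of_support_subset fun x hx => by_contra fun h0 => hx (hs x h0))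

/-- Coercivity of the form for test functions passes to its closure. -/
theorem norm_sq_le_of_cover {W : Set (E d)} (hW : MeasurableSet W)
    (T : Finset (E d)) (R : ℝ) (hT : ∀ v ∈ T, ‖v‖ ≤ R)
    (hcov : ∀ y ∈ Λ, ∃ v ∈ T, y - v ∈ W) {p : L2 Λ × (Fin d → L2 Λ)}
    (hp : p ∈ dirichletGradient Λ) :
    ‖p.1‖ ^ 2 ≤ T.card *
      (2 * (inner ℂ p.1 (mulOp (memLp_indicator_one hW) p.1)).re + 2 * R ^ 2 * ∑ i, ‖p.2 i‖ ^ 2) := by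
  revert hp p
  suffices h : closure (testGradient Λ) ⊆ {p | ‖p.1‖ ^ 2 ≤ T.card *
      (2 * (inner ℂ p.1 (mulOp (memLp_indicator_one hW) p.1)).re + 2 * R ^ 2 * ∑ i, ‖p.2 i‖ ^ 2)}
    from fun {p} hp => h hp
  refine closure_minimal ?_ (isClosed_le (by fun_prop) (by fun_prop))
  rintro ⟨f, F⟩ ⟨ψ, h1, h2, h3, h4, h5⟩
  simp only [mem_ofPred_eq]
  have hsupp : Function.support ψ ⊆ Λ := (subset_tsupport ψ).trans h3
  have hzero : ∀ x, x ∉ Λ → ψ x = 0 := fun x hx => by_contra fun h0 => hx (hsupp h0)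
  have hf : ENNReal.ofReal (‖f‖ ^ 2) = ∫⁻ x, ‖ψ x‖ₑ ^ 2 := by
    rw [ENNReal.ofReal_pow (norm_nonneg _), ofReal_norm, enorm_sq_eq_lintegral]
    refine setLIntegral_eq_of_ae_eq (fun x hx => by simp [hzero x hx]) ?_
    filter_upwards [h4] with y hy
    simp_all
  have hF : ENNReal.ofReal (∑ i, ‖F i‖ ^ 2) = ∫⁻ x, gradSq ψ x := by
    rw [ENNReal.ofReal_sum_of_nonneg (fun i _ => by positivity)]
    unfold gradSq
    rw [lintegral_finsetSum]
    · refine Finset.sum_congr rfl fun i _ => ?_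
      rw [ENNReal.ofReal_pow (norm_nonneg _), ofReal_norm, enorm_sq_eq_lintegral]
      refine setLIntegral_eq_of_ae_eq (fun x hx => ?_) ?_
      · have : fderiv ℝ ψ x = 0 := by
          by_contra h0
          exact hx (h3 (tsupport_fderiv_subset ℝ (subset_tsupport _ h0)))
        simp [this]
      · filter_upwards [h5 i] with y hy
        simp_all
    · intro i _
      have hc : Continuous (fderiv ℝ ψ) := h1.continuous_fderiv (by simp)
      have : Continuous fun x => fderiv ℝ ψ x (EuclideanSpace.single i 1) := by fun_prop
      exact this.measurable.enorm.pow_const 2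
  have hw : ENNReal.ofReal (inner ℂ f (mulOp (memLp_indicator_one hW) f)).re
      = ∫⁻ x in W, ‖ψ x‖ₑ ^ 2 := by
    rw [re_inner_mulOp_self, ofReal_integral_eq_lintegral_ofReal
      (integrable_mul_norm_sq (memLp_indicator_one hW) f)
      (Eventually.of_forall fun y => mul_nonneg (indicator_nonneg (by simp) _) (by positivity))]
    rw [← lintegral_indicator hW]
    refine setLIntegral_eq_of_ae_eq (fun x hx => ?_) ?_
    · by_cases hxW : x ∈ W <;> simp [hzero x hx, hxW]
    · filter_upwards [h4] with y hy
      by_cases hyW : y ∈ W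
      · simp only [hyW, indicator_of_mem, one_mul]
        rw [ENNReal.ofReal_pow (norm_nonneg _), ofReal_norm]
        simp_all
      · simp [hyW]
  have hpos : 0 ≤ (inner ℂ f (mulOp (memLp_indicator_one hW) f)).re := by
    rw [re_inner_mulOp_self]
    exact integral_nonneg fun y => mul_nonneg (indicator_nonneg (by simp) _) (by positivity)
  have key := lintegral_sq_le_of_cover h1 hW hsupp T R hT hcov
  rw [← hf, ← hF, ← hw] at key
  have h5' : (T.card : ℝ≥0∞) = ENNReal.ofReal T.card := by simp
  have h6 : ∀ r : ℝ, (2 : ℝ≥0∞) * ENNReal.ofReal r = ENNReal.ofReal (2 * r) := fun r => by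
    rw [ENNReal.ofReal_mul (by norm_num), ENNReal.ofReal_ofNat]
  rw [h6, h6, ← ENNReal.ofReal_mul (by positivity),
    ← ENNReal.ofReal_add (by positivity) (by positivity), h5',
    ← ENNReal.ofReal_mul (by positivity)] at key
  exact (ENNReal.ofReal_le_ofReal_iff (by positivity)).1 key

end PoissonHam

namespace PoissonHam

/-! ### Coercive forms on a Hilbert space -/

section Abstract

variable {H : Type*} [NormedAddCommGroup H] [InnerProductSpace ℂ H]

theorem re_inner_self_eq (ψ : H) : (inner ℂ ψ ψ : ℂ).re = ‖ψ‖ ^ 2 := by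
  have := inner_self_eq_norm_sq (𝕜 := ℂ) ψ
  simpa using this

/-- The algebra of the Combes–Thomas estimate. Here `w` is multiplication by `exp (a · z)`, `G` is
the gradient of `φ`, and the conjugated form is tested against the conjugated solution `w φ`. The
cross terms cancel in the real part, so the form is lowered by `‖a‖²` only. -/
theorem norm_conj_le {d : ℕ} {w V : H →L[ℂ] H}
    (hsym : ∀ g k : H, inner ℂ (w g) k = inner ℂ g (w k)) (hcomm : ∀ g, w (V g) = V (w g))
    {E₀ Eₙ : ℝ} (a : Fin d → ℝ) {φ f : H} {G : Fin d → H}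
    (h2 : ∑ i, inner ℂ (w (w (G i) + (a i : ℂ) • w φ) + (a i : ℂ) • w (w φ)) (G i) =
      inner ℂ (w (w φ)) (f + (Eₙ : ℂ) • φ - V φ))
    (hE : E₀ * ‖w φ‖ ^ 2 ≤ ∑ i, ‖w (G i) + (a i : ℂ) • w φ‖ ^ 2 + (inner ℂ (w φ) (V (w φ))).re) :
    (E₀ - Eₙ - ∑ i, a i ^ 2) * ‖w φ‖ ≤ ‖w f‖ := by
  generalize hψ : w φ = ψ at *
  have h3 : ∀ i, (inner ℂ (w (w (G i) + (a i : ℂ) • ψ) + (a i : ℂ) • w ψ) (G i)).re =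
      ‖w (G i) + (a i : ℂ) • ψ‖ ^ 2 - a i ^ 2 * ‖ψ‖ ^ 2 := by
    intro i
    rw [← map_smul, ← map_add, hsym]
    generalize hΓ : w (G i) + (a i : ℂ) • ψ = Γ
    have e2 : w (G i) = Γ - (a i : ℂ) • ψ := by rw [← hΓ, add_sub_cancel_right]
    rw [e2]
    have h4 : (inner ℂ Γ ψ).re = (inner ℂ ψ Γ).re := by
      rw [← inner_conj_symm, Complex.conj_re]
    simp only [inner_add_left, inner_sub_right, inner_smul_left, inner_smul_right,
      Complex.conj_ofReal, Complex.add_re, Complex.sub_re, Complex.re_ofReal_mul,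
      re_inner_self_eq, h4]
    ring
  have h7 := congrArg Complex.re h2
  rw [Complex.re_sum, Finset.sum_congr rfl fun i _ => h3 i, Finset.sum_sub_distrib,
    ← Finset.sum_mul, hsym, map_sub, map_add, map_smul, hcomm, hψ, inner_sub_right,
    inner_add_right, inner_smul_right, Complex.sub_re, Complex.add_re, Complex.re_ofReal_mul,
    re_inner_self_eq] at h7
  have h9 : (inner ℂ ψ (w f)).re ≤ ‖ψ‖ * ‖w f‖ :=
    (Complex.re_le_norm _).trans (norm_inner_le_norm _ _)
  have h10 : (E₀ - Eₙ - ∑ i, a i ^ 2) * ‖ψ‖ ^ 2 ≤ ‖ψ‖ * ‖w f‖ := by linarith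
  rcases (norm_nonneg ψ).eq_or_lt with h0 | h0
  · rw [← h0, mul_zero]
    positivity
  · refine le_of_mul_le_mul_left ?_ h0
    linarith

variable {ι : Type*}

/-- The bounded block operator on `H^{1+ι}` that acts as `T` on the component `none` (the function)
and as the identity on the other components (the gradient). -/
noncomputable def blockOp (T : H →L[ℂ] H) :
    (PiLp 2 fun _ : Option ι => H) →L[ℂ] (PiLp 2 fun _ : Option ι => H) :=
  (PiLp.continuousLinearEquiv 2 ℂ (fun _ : Option ι => H)).symm.toContinuousLinearMap.comp
    (ContinuousLinearMap.pi fun o : Option ι =>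
      (o.elim T fun _ => ContinuousLinearMap.id ℂ H).comp
        (PiLp.proj 2 (𝕜 := ℂ) (fun _ : Option ι => H) o))

theorem blockOp_none (T : H →L[ℂ] H) (x : PiLp 2 fun _ : Option ι => H) :
    blockOp T x none = T (x none) := rfl

theorem blockOp_some (T : H →L[ℂ] H) (x : PiLp 2 fun _ : Option ι => H)
    (i : ι) : blockOp T x (some i) = x (some i) := rfl

variable (H ι) in
/-- The embedding of `H` into `H^{1+ι}` as the component `none`. -/
noncomputable def inclNone : H →L[ℂ] (PiLp 2 fun _ : Option ι => H) :=
  (PiLp.continuousLinearEquiv 2 ℂ (fun _ : Option ι => H)).symm.toContinuousLinearMap.comp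
    (ContinuousLinearMap.pi fun o : Option ι => o.elim (ContinuousLinearMap.id ℂ H) fun _ => 0)

theorem inclNone_none (f : H) : inclNone H ι f none = f := rfl

theorem inclNone_some (f : H) (i : ι) : inclNone H ι f (some i) = 0 := rfl

/-- Solvability of the weak equation for a coercive form (Lax–Milgram), with a bounded solution
operator. The subspace `K` plays the role of the graph of the gradient. -/
theorem exists_solutionOp [Fintype ι] [CompleteSpace H] (K : Submodule ℂ (PiLp 2 fun _ : Option ι => H))
    (hK : IsClosed (K : Set (PiLp 2 fun _ : Option ι => H))) (V : H →L[ℂ] H) {E₀ Eₙ : ℝ}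
    (h0 : 0 < E₀)
    (hE : ∀ x ∈ K, E₀ * ‖x none‖ ^ 2 ≤ ∑ i, ‖x (some i)‖ ^ 2 + (inner ℂ (x none) (V (x none))).re)
    (hV0 : ∀ g, 0 ≤ (inner ℂ g (V g)).re) (hEn : 4 * Eₙ ≤ E₀) :
    ∃ R : H →L[ℂ] H, ∀ f, ∃ x ∈ K, x none = R f ∧ ∀ y ∈ K,
      ∑ i, inner ℂ (y (some i)) (x (some i)) =
        inner ℂ (y none) (f + (Eₙ : ℂ) • x none - V (x none)) := by
  have : CompleteSpace K := hK.completeSpace_coe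
  set P := K.orthogonalProjectionOnto with hP
  set D := blockOp (ι := ι) (V - (Eₙ : ℂ) • ContinuousLinearMap.id ℂ H) with hD
  set A : K →L[ℂ] K := P.comp (D.comp K.subtypeL) with hA
  have hPin : ∀ (y : PiLp 2 fun _ : Option ι => H) (x : K),
      inner ℂ x (P y) = inner ℂ (x : PiLp 2 fun _ : Option ι => H) y := fun y x =>
    Submodule.inner_orthogonalProjectionOnto_eq_of_mem_left x y
  have hc : 0 < min (1 / 2) (E₀ / 4) := by positivity
  have hunit : IsUnit A := by
    refine ContinuousLinearMap.isUnit_of_forall_le_norm_inner_map A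
      (c := ⟨min (1 / 2) (E₀ / 4), hc.le⟩) hc fun x => ?_
    have h1 : inner ℂ (A x) x = (starRingEnd ℂ)
        (inner ℂ (x : PiLp 2 fun _ : Option ι => H) (D x)) :=
      (inner_conj_symm (A x) x).symm.trans (congrArg _ (hPin (D x) x))
    have h2 := hE _ x.2
    rw [h1, RCLike.norm_conj]
    refine le_trans ?_ (Complex.re_le_norm _)
    rw [Submodule.coe_norm, PiLp.norm_sq_eq_of_L2, PiLp.inner_apply, Fintype.sum_option,
      Fintype.sum_option, hD, blockOp_none]
    generalize hx0 : (x : PiLp 2 fun _ : Option ι => H) = z at *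
    have h7 := hV0 (z none)
    simp only [blockOp_some, ContinuousLinearMap.id_apply, _root_.sub_apply,
      _root_.smul_apply, inner_sub_right, inner_smul_right, Complex.add_re,
      Complex.sub_re, Complex.re_ofReal_mul, Complex.re_sum, re_inner_self_eq]
    generalize (inner ℂ (z none) (V (z none))).re = v at *
    have hq : 0 ≤ ∑ i, ‖z (some i)‖ ^ 2 := by positivity
    have hp : 0 ≤ ‖z none‖ ^ 2 := by positivity
    have hc1 : min (1 / 2) (E₀ / 4) ≤ 1 / 2 := min_le_left _ _
    have hc2 : min (1 / 2) (E₀ / 4) ≤ E₀ / 4 := min_le_right _ _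
    change (‖z none‖ ^ 2 + ∑ i, ‖z (some i)‖ ^ 2) * min (1 / 2) (E₀ / 4) ≤ _
    generalize (∑ i, ‖z (some i)‖ ^ 2) = q at *
    generalize ‖z none‖ ^ 2 = p at *
    nlinarith [mul_le_mul_of_nonneg_left hc1 hq, mul_le_mul_of_nonneg_left hc2 hp,
      mul_le_mul_of_nonneg_left hEn hp]
  obtain ⟨U, hU⟩ := hunit
  refine ⟨(PiLp.proj 2 (𝕜 := ℂ) (fun _ : Option ι => H) none).comp
    (K.subtypeL.comp ((↑U⁻¹ : K →L[ℂ] K).comp (P.comp (inclNone H ι)))), fun f => ?_⟩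
  set x : K := (↑U⁻¹ : K →L[ℂ] K) (P (inclNone H ι f)) with hx
  have hAx : A x = P (inclNone H ι f) := by
    rw [hx, ← hU]
    exact congrArg (fun T : K →L[ℂ] K => T (P (inclNone H ι f))) U.mul_inv
  refine ⟨x, x.2, rfl, fun y hy => ?_⟩
  have h1 : inner ℂ y (D x) = inner ℂ y (inclNone H ι f) := by
    rw [← hPin _ ⟨y, hy⟩, ← hPin _ ⟨y, hy⟩, ← hAx]
    rfl
  rw [PiLp.inner_apply, PiLp.inner_apply, Fintype.sum_option, Fintype.sum_option] at h1
  simp only [hD, blockOp_none, blockOp_some, inclNone_none, inclNone_some, inner_zero_right,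
    Finset.sum_const_zero, add_zero] at h1
  rw [← eq_sub_iff_add_eq', ← inner_sub_right] at h1
  rw [h1]
  congr 1
  simp
  abel

end Abstract

variable {d : ℕ} {Λ : Set (E d)}

/-! ### Exponential weights -/

/-- The exponential weight `z ↦ exp (a · z)`. -/
noncomputable def expWeight {d : ℕ} (a z : E d) : ℝ := Real.exp (inner ℝ a z)

theorem contDiff_expWeight (a : E d) : ContDiff ℝ (⊤ : ℕ∞) (expWeight a) :=
  (innerSL ℝ a).contDiff.exp

theorem fderiv_expWeight (a z : E d) (i : Fin d) :
    fderiv ℝ (expWeight a) z (EuclideanSpace.single i 1) = a i * expWeight a z := by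
  have h : HasFDerivAt (fun z : E d => inner ℝ a z) (innerSL ℝ a) z :=
    (innerSL ℝ a).hasFDerivAt
  have h2 : HasFDerivAt (expWeight a) (Real.exp (inner ℝ a z) • innerSL ℝ a) z := h.exp
  rw [h2.fderiv]
  simp [expWeight, EuclideanSpace.inner_single_right, mul_comm]

theorem memLp_expWeight (hΛ : MeasurableSet Λ) (hb : Bornology.IsBounded Λ) (a : E d) :
    MemLp (fun z => (expWeight a z : ℂ)) ∞ (volume.restrict Λ) := by
  obtain ⟨C, hC⟩ := hb.exists_norm_le
  refine memLp_top_of_bound ?_ (Real.exp (‖a‖ * C)) ?_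
  · exact (Complex.continuous_ofReal.comp
      (contDiff_expWeight a).continuous).aestronglyMeasurable
  · filter_upwards [ae_restrict_mem hΛ] with z hz
    rw [Complex.norm_real, expWeight, Real.norm_eq_abs, abs_of_pos (Real.exp_pos _)]
    refine Real.exp_le_exp.2 ((real_inner_le_norm a z).trans ?_)
    gcongr
    exact hC z hz

/-- The form domain is invariant under multiplication by an exponential weight. -/
theorem expWeight_mem_dirichletGradient {a : E d}
    (hw : MemLp (fun z => (expWeight a z : ℂ)) ∞ (volume.restrict Λ))
    {p : L2 Λ × (Fin d → L2 Λ)} (hp : p ∈ dirichletGradient Λ) :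
    (mulOp hw p.1, fun i => mulOp hw (p.2 i) + (a i : ℂ) • mulOp hw p.1) ∈ dirichletGradient Λ := by
  have hcont : Continuous fun p : L2 Λ × (Fin d → L2 Λ) =>
      (mulOp hw p.1, fun i => mulOp hw (p.2 i) + (a i : ℂ) • mulOp hw p.1) := by
    have hc1 : Continuous fun p : L2 Λ × (Fin d → L2 Λ) => mulOp hw p.1 :=
      (mulOp hw).continuous.comp continuous_fst
    have hc2 : ∀ i, Continuous fun p : L2 Λ × (Fin d → L2 Λ) => mulOp hw (p.2 i) := fun i =>
      (mulOp hw).continuous.comp ((continuous_apply i).comp continuous_snd)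
    exact hc1.prodMk (continuous_pi fun i => (hc2 i).add (hc1.const_smul (a i : ℂ)))
  refine map_mem_closure (f := fun p : L2 Λ × (Fin d → L2 Λ) =>
      (mulOp hw p.1, fun i => mulOp hw (p.2 i) + (a i : ℂ) • mulOp hw p.1)) hcont hp ?_
  rintro ⟨f, F⟩ ⟨ψ, h1, h2, h3, h4, h5⟩
  have k1 : ContDiff ℝ (⊤ : ℕ∞) fun z => (expWeight a z : ℝ) • ψ z := (contDiff_expWeight a).smul h1
  have k2 : HasCompactSupport fun z => (expWeight a z : ℝ) • ψ z :=
    HasCompactSupport.smul_left (f := expWeight a) (f' := ψ) h2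
  have k3 : tsupport (fun z => (expWeight a z : ℝ) • ψ z) ⊆ Λ :=
    (tsupport_smul_subset_right (expWeight a) ψ).trans h3
  dsimp only at h4 h5 ⊢
  refine ⟨_, k1, k2, k3, ?_, fun i => ?_⟩
  · filter_upwards [h4, mulOp_coe hw f] with y a1 a2
    rw [Complex.real_smul]
    exact a2.trans (by rw [a1])
  · filter_upwards [h4, h5 i, mulOp_coe hw f, mulOp_coe hw (F i),
      Lp.coeFn_add (mulOp hw (F i)) ((a i : ℂ) • mulOp hw f),
      Lp.coeFn_smul (a i : ℂ) (mulOp hw f)] with y b1 b2 b3 b4 b5 b6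
    have hfd : fderiv ℝ (fun z => (expWeight a z : ℝ) • ψ z) y =
        expWeight a y • fderiv ℝ ψ y + (fderiv ℝ (expWeight a) y).smulRight (ψ y) :=
      fderiv_fun_smul ((contDiff_expWeight a).differentiable (by simp)).differentiableAt
        (h1.differentiable (by simp)).differentiableAt
    rw [b5]
    rw [hfd, Pi.add_apply, b4, b6, Pi.smul_apply, b3]
    rw [_root_.add_apply, _root_.smul_apply,
      ContinuousLinearMap.smulRight_apply, fderiv_expWeight, Complex.real_smul, Complex.real_smul]
    rw [show F i y = _ from b2, show f y = _ from b1]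
    push_cast
    rw [smul_eq_mul]
    ring

theorem mulOp_comm {α : Type*} [MeasurableSpace α] {μ : Measure α} {v w : α → ℂ}
    (hv : MemLp v ∞ μ) (hw : MemLp w ∞ μ) (f : Lp ℂ 2 μ) :
    mulOp hv (mulOp hw f) = mulOp hw (mulOp hv f) := by
  refine Lp.ext ?_
  filter_upwards [mulOp_coe hv (mulOp hw f), mulOp_coe hw f, mulOp_coe hw (mulOp hv f),
    mulOp_coe hv f] with y h1 h2 h3 h4
  rw [h1, h2, h3, h4]
  ring

/-- The weak form of the Schrödinger equation. -/
theorem mem_schrodinger_iff {V : E d → ℝ}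
    (hV : MemLp (fun y => (V y : ℂ)) ∞ (volume.restrict Λ)) (φ f : L2 Λ) :
    (φ, f) ∈ schrodinger Λ V ↔ (φ, f - mulOp hV φ) ∈ negDirichletLaplacian Λ := by
  constructor
  · rintro ⟨g, hg, h⟩
    have : f - mulOp hV φ = g := by
      rw [sub_eq_iff_eq_add]
      refine Lp.ext ?_
      filter_upwards [h, mulOp_coe hV φ, Lp.coeFn_add g (mulOp hV φ)] with y h1 h2 h3
      rw [h3, Pi.add_apply, h2]
      exact h1
    rwa [this]
  · intro h
    refine ⟨_, h, ?_⟩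
    filter_upwards [mulOp_coe hV φ, Lp.coeFn_sub f (mulOp hV φ)] with y h2 h3
    rw [h3, Pi.sub_apply, h2]
    ring

/-- The quadratic form of `-Δ_Λ + V` is bounded from below by `E₀`. -/
def FormBound {V : E d → ℝ} (hV : MemLp (fun y => (V y : ℂ)) ∞ (volume.restrict Λ))
    (E₀ : ℝ) : Prop :=
  ∀ p ∈ dirichletGradient Λ, E₀ * ‖p.1‖ ^ 2 ≤
    ∑ i, ‖p.2 i‖ ^ 2 + (inner ℂ p.1 (mulOp hV p.1)).re

/-- The Combes–Thomas estimate with a linear weight. -/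
theorem norm_expWeight_mul_le {a : E d}
    (hw : MemLp (fun z => (expWeight a z : ℂ)) ∞ (volume.restrict Λ))
    {V : E d → ℝ} (hV : MemLp (fun y => (V y : ℂ)) ∞ (volume.restrict Λ)) {E₀ Eₙ : ℝ}
    (hE : FormBound hV E₀) {φ f : L2 Λ} (h : (φ, f + (Eₙ : ℂ) • φ) ∈ schrodinger Λ V) :
    (E₀ - Eₙ - ‖a‖ ^ 2) * ‖mulOp hw φ‖ ≤ ‖mulOp hw f‖ := by
  rw [mem_schrodinger_iff hV] at h
  obtain ⟨G, hG, hq⟩ := h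
  have h1 := expWeight_mem_dirichletGradient hw hG
  have h2 := hq _ (expWeight_mem_dirichletGradient hw h1)
  have h3 := hE _ h1
  dsimp only at h2 h3
  rw [EuclideanSpace.real_norm_sq_eq]
  exact norm_conj_le (w := mulOp hw) (V := mulOp hV) (E₀ := E₀) (Eₙ := Eₙ) (φ := φ) (f := f)
    (G := G) (inner_mulOp_left hw) (mulOp_comm hw hV) a h2 h3

/-! ### The resolvent -/

/-- The form domain as a subspace of the Hilbert space `L²(Λ)^{1+d}`. -/
noncomputable def formDomain {d : ℕ} (Λ : Set (E d)) :
    Submodule ℂ (PiLp 2 fun _ : Option (Fin d) => L2 Λ) :=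
  (testSubmodule Λ).topologicalClosure.comap
    ((PiLp.proj 2 (𝕜 := ℂ) (fun _ : Option (Fin d) => L2 Λ) none).prod
      (ContinuousLinearMap.pi fun i : Fin d =>
        PiLp.proj 2 (𝕜 := ℂ) (fun _ : Option (Fin d) => L2 Λ) (some i))).toLinearMap

theorem mem_formDomain (x : PiLp 2 fun _ : Option (Fin d) => L2 Λ) :
    x ∈ formDomain Λ ↔ (x none, fun i => x (some i)) ∈ dirichletGradient Λ := Iff.rfl

theorem isClosed_formDomain : IsClosed (formDomain Λ : Set (PiLp 2 fun _ : Option (Fin d) => L2 Λ)) :=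
  (Submodule.isClosed_topologicalClosure (testSubmodule Λ)).preimage
    ((PiLp.proj 2 (𝕜 := ℂ) (fun _ : Option (Fin d) => L2 Λ) none).prod
      (ContinuousLinearMap.pi fun i : Fin d =>
        PiLp.proj 2 (𝕜 := ℂ) (fun _ : Option (Fin d) => L2 Λ) (some i))).continuous

/-- Existence of the resolvent, without its uniqueness: below the form bound, `(H - Eₙ) φ = f` has a
solution that depends continuously on `f`. -/
theorem exists_resolvent {V : E d → ℝ}
    (hV : MemLp (fun y => (V y : ℂ)) ∞ (volume.restrict Λ)) {E₀ Eₙ : ℝ} (h0 : 0 < E₀)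
    (hE : FormBound hV E₀) (hV0 : ∀ᵐ y ∂(volume.restrict Λ), 0 ≤ V y) (hEn : 4 * Eₙ ≤ E₀) :
    ∃ R : L2 Λ →L[ℂ] L2 Λ, ∀ f, (R f, f + (Eₙ : ℂ) • R f) ∈ schrodinger Λ V := by
  obtain ⟨R, hR⟩ := exists_solutionOp (formDomain Λ) isClosed_formDomain (mulOp hV) h0
    (fun x hx => hE (x none, fun i => x (some i)) ((mem_formDomain x).1 hx)) (fun g => by
      rw [re_inner_mulOp_self]
      refine integral_nonneg_of_ae ?_
      filter_upwards [hV0] with y hy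
      exact mul_nonneg hy (by positivity)) hEn
  refine ⟨R, fun f => ?_⟩
  obtain ⟨x, hx, hxR, h⟩ := hR f
  rw [mem_schrodinger_iff hV, ← hxR]
  exact ⟨fun i => x (some i), (mem_formDomain x).1 hx, fun q hq =>
    h (WithLp.toLp 2 fun o => o.elim q.1 q.2) ((mem_formDomain _).2 hq)⟩

end PoissonHam

namespace PoissonHam

/-! ### Boxes -/

variable {d : ℕ}

theorem box_subset_box {x y : E d} {s L : ℝ} (h : ∀ i, |y i - x i| ≤ (L - s) / 2) :
    box y s ⊆ box x L := by
  intro z hz i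
  have h1 := abs_lt.1 (hz i)
  have h2 := abs_le.1 (h i)
  exact abs_lt.2 ⟨by linarith, by linarith⟩

theorem norm_le_of_abs_le {z : E d} {c : ℝ} (hc : 0 ≤ c) (h : ∀ i, |z i| ≤ c) :
    ‖z‖ ≤ Real.sqrt d * c := by
  rw [EuclideanSpace.norm_eq]
  calc Real.sqrt (∑ i, ‖z i‖ ^ 2) ≤ Real.sqrt (∑ _i : Fin d, c ^ 2) := by
        gcongr with i
        exact h i
    _ = Real.sqrt d * c := by
        rw [Finset.sum_const, Finset.card_univ, Fintype.card_fin, nsmul_eq_mul,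
          Real.sqrt_mul (by positivity), Real.sqrt_sq hc]

theorem norm_sub_le_of_mem_box {y z : E d} {s : ℝ} (hs : 0 ≤ s) (hz : z ∈ box y s) :
    ‖z - y‖ ≤ Real.sqrt d * (s / 2) :=
  norm_le_of_abs_le (by positivity) fun i => (hz i).le

theorem isBounded_box (x : E d) (L : ℝ) : Bornology.IsBounded (box x L) := by
  refine (isBounded_iff_forall_norm_le.2 ⟨‖x‖ + Real.sqrt d * (|L| / 2), fun z hz => ?_⟩)
  have hz' : z ∈ box x |L| := fun i => (hz i).trans_le (by gcongr; exact le_abs_self L)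
  have h := norm_sub_le_of_mem_box (abs_nonneg L) hz'
  calc ‖z‖ = ‖x + (z - x)‖ := by rw [add_sub_cancel]
    _ ≤ _ := (norm_add_le _ _).trans (by gcongr)

theorem volume_box (x : E d) (s : ℝ) : volume (box x s) = ENNReal.ofReal s ^ d := by
  have h := (PiLp.volume_preserving_ofLp (Fin d)).measure_preimage
    (s := Set.univ.pi fun i => Ioo (x i - s / 2) (x i + s / 2))
    (MeasurableSet.univ_pi fun i => measurableSet_Ioo).nullMeasurableSet
  have h2 : (@WithLp.ofLp 2 (Fin d → ℝ)) ⁻¹' (Set.univ.pi fun i => Ioo (x i - s / 2) (x i + s / 2))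
      = box x s := by
    ext z
    simp only [mem_preimage, mem_univ_pi, mem_Ioo, box, mem_ofPred_eq, abs_lt]
    exact forall_congr' fun i => ⟨fun h => ⟨by linarith [h.1], by linarith [h.2]⟩,
      fun h => ⟨by linarith [h.1], by linarith [h.2]⟩⟩
  rw [h2] at h
  rw [h, volume_pi_pi]
  simp

/-- About `(ρ / r)^d` translates of the box of side `r` at the origin cover the cube of side `2ρ`. -/
theorem exists_finset_translations {r ρ : ℝ} (hr : 0 < r) (hρ : 0 ≤ ρ) :
    ∃ T : Finset (E d), (T.card : ℝ) ≤ (4 * ρ / r + 5) ^ d ∧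
      (∀ v ∈ T, ‖v‖ ≤ Real.sqrt d * (ρ + r)) ∧
      ∀ y ζ : E d, (∀ i, |y i - ζ i| ≤ ρ) → ∃ v ∈ T, y - v ∈ box ζ r := by
  classical
  set N : ℕ := ⌈2 * ρ / r⌉₊ + 1 with hN
  have hN1 : 2 * ρ / r + 1 ≤ N := by
    rw [hN]; push_cast; gcongr; exact Nat.le_ceil _
  have hN2 : (N : ℝ) ≤ 2 * ρ / r + 2 := by
    rw [hN]; push_cast
    linarith [(Nat.ceil_lt_add_one (show 0 ≤ 2 * ρ / r by positivity)).le]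
  let g : (Fin d → ℤ) → E d := fun k => WithLp.toLp 2 fun i => r / 2 * k i
  refine ⟨(Fintype.piFinset fun _ : Fin d => Finset.Icc (-(N : ℤ)) N).image g, ?_, ?_, ?_⟩
  · have h1 : ((Fintype.piFinset fun _ : Fin d => Finset.Icc (-(N : ℤ)) N).image g).card ≤
        (2 * N + 1) ^ d := by
      refine Finset.card_image_le.trans (le_of_eq ?_)
      rw [Fintype.card_piFinset_const, Int.card_Icc]
      congr 1
      omega
    calc (((Fintype.piFinset fun _ : Fin d => Finset.Icc (-(N : ℤ)) N).image g).card : ℝ)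
        ≤ (2 * N + 1 : ℝ) ^ d := by exact_mod_cast h1
      _ ≤ (4 * ρ / r + 5) ^ d := by
          have : (2 * N + 1 : ℝ) ≤ 4 * ρ / r + 5 := by linear_combination 2 * hN2
          gcongr
  · intro v hv
    obtain ⟨k, hk, rfl⟩ := Finset.mem_image.1 hv
    refine norm_le_of_abs_le (by positivity) fun i => ?_
    have hki := Finset.mem_Icc.1 (Fintype.mem_piFinset.1 hk i)
    have hk2 : |(k i : ℝ)| ≤ N := by
      rw [abs_le]; exact ⟨by exact_mod_cast hki.1, by exact_mod_cast hki.2⟩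
    calc |r / 2 * (k i : ℝ)| = r / 2 * |(k i : ℝ)| := by rw [abs_mul, abs_of_pos (by positivity)]
      _ ≤ r / 2 * (2 * ρ / r + 2) := by gcongr; exact hk2.trans hN2
      _ = ρ + r := by field_simp
  · intro y ζ h
    refine ⟨g fun i => round ((y i - ζ i) / (r / 2)), Finset.mem_image_of_mem _
      (Fintype.mem_piFinset.2 fun i => ?_), fun i => ?_⟩
    · have h1 := abs_sub_round ((y i - ζ i) / (r / 2))
      have h2 : |(y i - ζ i) / (r / 2)| ≤ 2 * ρ / r := by
        rw [abs_div, abs_of_pos (show 0 < r / 2 by positivity), div_le_iff₀ (by positivity)]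
        calc _ ≤ ρ := h i
          _ = _ := by field_simp
      have h3 : |(round ((y i - ζ i) / (r / 2)) : ℝ)| ≤ N := by
        rw [abs_le] at h1 h2 ⊢
        constructor <;> linarith
      rw [abs_le] at h3
      exact Finset.mem_Icc.2 ⟨by exact_mod_cast h3.1, by exact_mod_cast h3.2⟩
    · have h1 := abs_sub_round ((y i - ζ i) / (r / 2))
      change |y i - r / 2 * (round ((y i - ζ i) / (r / 2)) : ℤ) - ζ i| < r / 2
      have h2 : y i - r / 2 * (round ((y i - ζ i) / (r / 2)) : ℤ) - ζ i =
          r / 2 * ((y i - ζ i) / (r / 2) - round ((y i - ζ i) / (r / 2))) := by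
        field_simp
        ring
      rw [h2, abs_mul, abs_of_pos (show 0 < r / 2 by positivity)]
      nlinarith

/-! ### The potential -/

theorem ae_translate {p : E d → Prop} (h : ∀ᵐ y ∂(volume : Measure (E d)), p y) (ζ : E d) :
    ∀ᵐ y ∂(volume : Measure (E d)), p (y - ζ) :=
  (measurePreserving_sub_right volume ζ).quasiMeasurePreserving.ae h

namespace SingleSite

variable (u : SingleSite d)

theorem nonneg_ae : ∀ᵐ y ∂(volume : Measure (E d)), 0 ≤ u.u y := by
  filter_upwards [u.lower] with y hy
  exact (indicator_nonneg (fun _ _ => u.uMinus_pos.le) y).trans hy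

theorem memLp_translate (ζ : E d) : MemLp (fun y => u.u (y - ζ)) ∞ (volume : Measure (E d)) := by
  refine memLp_top_of_bound ?_ u.uPlus ?_
  · exact (u.aemeasurable.comp_quasiMeasurePreserving
      (measurePreserving_sub_right volume ζ).quasiMeasurePreserving).aestronglyMeasurable
  · filter_upwards [ae_translate u.upper ζ, ae_translate u.nonneg_ae ζ] with y h1 h2
    rw [Real.norm_eq_abs, abs_of_nonneg h2]
    refine h1.trans ?_
    exact indicator_le_self' (fun _ _ => u.uPlus_pos.le) _

end SingleSite

theorem potential_eq_sum (u : SingleSite d) {Λ B S : Set (E d)} (hB : B.Finite) (hS : S.Finite)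
    (hBΛ : B ⊆ Λ) (hSΛ : S ⊆ Λ) (t : E d → ℝ) (y : E d) :
    potential u Λ B S t y =
      ∑ ζ ∈ hB.toFinset, u.u (y - ζ) + ∑ ζ ∈ hS.toFinset, t ζ * u.u (y - ζ) := by
  have h : ∀ (A : Set (E d)) (hA : A.Finite) (g : E d → ℝ), A ⊆ Λ →
      ∑' ζ : ↥(A ∩ Λ), g ζ = ∑ ζ ∈ hA.toFinset, g ζ := by
    intro A hA g hAΛ
    have h := Finset.tsum_subtype' hA.toFinset g
    rw [hA.coe_toFinset] at h
    rw [inter_eq_left.2 hAΛ]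
    exact h
  rw [potential, h B hB (fun ζ => u.u (y - ζ)) hBΛ, h S hS (fun ζ => t ζ * u.u (y - ζ)) hSΛ]

theorem memLp_potential (u : SingleSite d) {Λ B S : Set (E d)} (hB : B.Finite) (hS : S.Finite)
    (hBΛ : B ⊆ Λ) (hSΛ : S ⊆ Λ) (t : E d → ℝ) :
    MemLp (fun y => (potential u Λ B S t y : ℂ)) ∞ ((volume : Measure (E d)).restrict Λ) := by
  have h : MemLp (potential u Λ B S t) ∞ ((volume : Measure (E d)).restrict Λ) := by
    rw [funext (potential_eq_sum u hB hS hBΛ hSΛ t)]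
    refine MemLp.add (memLp_finsetSum _ fun ζ _ => (u.memLp_translate ζ).restrict Λ)
      (memLp_finsetSum _ fun ζ _ => ((u.memLp_translate ζ).restrict Λ).const_mul (t ζ))
  exact h.ofReal

theorem indicator_le_potential (u : SingleSite d) {Λ B S : Set (E d)} (hB : B.Finite)
    (hS : S.Finite) (hBΛ : B ⊆ Λ) (hSΛ : S ⊆ Λ) {t : E d → ℝ} (ht : ∀ ζ ∈ S, t ζ ∈ Icc (0 : ℝ) 1) :
    ∀ᵐ y ∂((volume : Measure (E d)).restrict Λ),
      (⋃ ζ ∈ B, box ζ u.deltaMinus).indicator (fun _ => u.uMinus) y ≤ potential u Λ B S t y := by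
  refine ae_restrict_of_ae ?_
  have h1 : ∀ᵐ y ∂(volume : Measure (E d)), ∀ ζ ∈ hB.toFinset,
      (box 0 u.deltaMinus).indicator (fun _ => u.uMinus) (y - ζ) ≤ u.u (y - ζ) :=
    (ae_ball_iff hB.toFinset.countable_toSet).2 fun ζ _ => ae_translate u.lower ζ
  have h2 : ∀ᵐ y ∂(volume : Measure (E d)), ∀ ζ ∈ hB.toFinset, 0 ≤ u.u (y - ζ) :=
    (ae_ball_iff hB.toFinset.countable_toSet).2 fun ζ _ => ae_translate u.nonneg_ae ζ
  have h3 : ∀ᵐ y ∂(volume : Measure (E d)), ∀ ζ ∈ hS.toFinset, 0 ≤ u.u (y - ζ) :=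
    (ae_ball_iff hS.toFinset.countable_toSet).2 fun ζ _ => ae_translate u.nonneg_ae ζ
  filter_upwards [h1, h2, h3] with y k1 k2 k3
  rw [potential_eq_sum u hB hS hBΛ hSΛ]
  have k4 : 0 ≤ ∑ ζ ∈ hS.toFinset, t ζ * u.u (y - ζ) :=
    Finset.sum_nonneg fun ζ hζ => mul_nonneg (ht ζ (hS.mem_toFinset.1 hζ)).1 (k3 ζ hζ)
  by_cases hy : y ∈ ⋃ ζ ∈ B, box ζ u.deltaMinus
  · obtain ⟨ζ, hζ, hyζ⟩ := mem_iUnion₂.1 hy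
    have hζ' := hB.mem_toFinset.2 hζ
    have k5 := Finset.single_le_sum (f := fun ζ => u.u (y - ζ)) k2 hζ'
    have k6 := k1 ζ hζ'
    have k7 : y - ζ ∈ box 0 u.deltaMinus := fun i => by simpa using hyζ i
    rw [indicator_of_mem k7] at k6
    rw [indicator_of_mem hy]
    linarith
  · rw [indicator_of_notMem hy]
    have := Finset.sum_nonneg k2
    linarith

/-- A lower bound for the form of the Schrödinger operator whose scatterers are relatively dense:
every point of `Λ` is at distance at most `ρ`, in every coordinate, from a point of `B`. -/
theorem formBound_of_relDense (u : SingleSite d) {Λ B S : Set (E d)} (hB : B.Finite)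
    (hS : S.Finite) (hBΛ : B ⊆ Λ) (hSΛ : S ⊆ Λ) {t : E d → ℝ} (ht : ∀ ζ ∈ S, t ζ ∈ Icc (0 : ℝ) 1)
    {ρ : ℝ} (hρ : 0 ≤ ρ) (hdense : ∀ y ∈ Λ, ∃ ζ ∈ B, ∀ i, |y i - ζ i| ≤ ρ) {E₀ : ℝ} (h0 : 0 ≤ E₀)
    (hE₀ : E₀ * ((4 * ρ / u.deltaMinus + 5) ^ d *
      (2 / u.uMinus + 2 * (d * (ρ + u.deltaMinus) ^ 2))) ≤ 1) :
    FormBound (memLp_potential u hB hS hBΛ hSΛ t) E₀ := by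
  have hu := u.uMinus_pos
  have hδ := u.deltaMinus_pos
  obtain ⟨T, hT1, hT2, hT3⟩ := exists_finset_translations (d := d) hδ hρ
  set W := ⋃ ζ ∈ B, box ζ u.deltaMinus with hWdef
  have hW : MeasurableSet W := hB.measurableSet_biUnion fun ζ _ => measurableSet_box _ _
  intro p hp
  have h1 := norm_sq_le_of_cover hW T _ hT2 (fun y hy => by
    obtain ⟨ζ, hζ, h⟩ := hdense y hy
    obtain ⟨v, hv, hvb⟩ := hT3 y ζ h
    exact ⟨v, hv, mem_biUnion hζ hvb⟩) hp
  have hcW : MemLp (fun y => ((u.uMinus * W.indicator (fun _ => (1 : ℝ)) y : ℝ) : ℂ)) ∞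
      ((volume : Measure (E d)).restrict Λ) := by
    have := (memLp_indicator_one (μ := (volume : Measure (E d)).restrict Λ) hW).const_mul
      (u.uMinus : ℂ)
    simpa using this
  have h2 : u.uMinus * (inner ℂ p.1 (mulOp (memLp_indicator_one hW) p.1)).re ≤
      (inner ℂ p.1 (mulOp (memLp_potential u hB hS hBΛ hSΛ t) p.1)).re := by
    have h3 := re_inner_mulOp_mono hcW (memLp_potential u hB hS hBΛ hSΛ t) (by
      filter_upwards [indicator_le_potential u hB hS hBΛ hSΛ ht] with y hy
      refine le_trans (le_of_eq ?_) hy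
      by_cases hyW : y ∈ W
      · rw [indicator_of_mem hyW, indicator_of_mem hyW, mul_one]
      · rw [indicator_of_notMem hyW, indicator_of_notMem hyW, mul_zero]) p.1
    refine le_trans (le_of_eq ?_) h3
    rw [re_inner_mulOp_self, re_inner_mulOp_self, ← integral_const_mul]
    simp only [mul_assoc]
  have hpos : 0 ≤ (inner ℂ p.1 (mulOp (memLp_indicator_one hW) p.1)).re := by
    rw [re_inner_mulOp_self]
    exact integral_nonneg fun y => mul_nonneg (indicator_nonneg (by simp) _) (by positivity)
  rw [mul_pow, Real.sq_sqrt (Nat.cast_nonneg d)] at h1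
  set a := (inner ℂ p.1 (mulOp (memLp_indicator_one hW) p.1)).re
  set v := (inner ℂ p.1 (mulOp (memLp_potential u hB hS hBΛ hSΛ t) p.1)).re
  have hq : 0 ≤ ∑ i, ‖p.2 i‖ ^ 2 := by positivity
  set q := ∑ i, ‖p.2 i‖ ^ 2
  have hv : 0 ≤ v := (by positivity : 0 ≤ u.uMinus * a).trans h2
  have ha : a ≤ v / u.uMinus := by rw [le_div_iff₀ hu]; linarith
  have h4 : 2 * a + 2 * (d * (ρ + u.deltaMinus) ^ 2) * q ≤
      (2 / u.uMinus + 2 * (d * (ρ + u.deltaMinus) ^ 2)) * (q + v) := by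
    have e1 : 0 ≤ 2 / u.uMinus * q := by positivity
    have e2 : 0 ≤ 2 * (d * (ρ + u.deltaMinus) ^ 2) * v := by positivity
    have e3 : 2 * a ≤ 2 / u.uMinus * v := by
      calc 2 * a ≤ 2 * (v / u.uMinus) := by linarith
        _ = _ := by ring
    linarith
  calc E₀ * ‖p.1‖ ^ 2 ≤ E₀ * (T.card * (2 * a + 2 * (d * (ρ + u.deltaMinus) ^ 2) * q)) := by gcongr
    _ ≤ E₀ * ((4 * ρ / u.deltaMinus + 5) ^ d *
        ((2 / u.uMinus + 2 * (d * (ρ + u.deltaMinus) ^ 2)) * (q + v))) := by gcongr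
    _ = (E₀ * ((4 * ρ / u.deltaMinus + 5) ^ d *
      (2 / u.uMinus + 2 * (d * (ρ + u.deltaMinus) ^ 2)))) * (q + v) := by ring
    _ ≤ 1 * (q + v) := by gcongr
    _ = _ := one_mul _

/-! ### Good boxes -/

theorem norm_chi_comp_le {Λ : Set (E d)} {V : E d → ℝ} (hΛ : MeasurableSet Λ)
    (hb : Bornology.IsBounded Λ) (hV : MemLp (fun y => (V y : ℂ)) ∞ (volume.restrict Λ))
    {E₀ Eₙ θ : ℝ} (hθ : 0 ≤ θ) (hE : FormBound hV E₀) (hgap : E₀ / 2 ≤ E₀ - Eₙ - θ ^ 2)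
    (h0 : 0 < E₀) {R : L2 Λ →L[ℂ] L2 Λ}
    (hR : ∀ f, (R f, f + (Eₙ : ℂ) • R f) ∈ schrodinger Λ V) (y y' : E d) :
    ‖(chi Λ y).comp (R.comp (chi Λ y'))‖ ≤
      2 / E₀ * Real.exp (θ * Real.sqrt d) * Real.exp (-θ * ‖y - y'‖) := by
  refine ContinuousLinearMap.opNorm_le_bound _ (by positivity) fun g => ?_
  set e : E d := ‖y - y'‖⁻¹ • (y - y') with he
  set a : E d := θ • e with ha
  have hnorm : ‖a‖ ≤ θ := by
    rw [ha, norm_smul, Real.norm_eq_abs, abs_of_nonneg hθ]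
    refine mul_le_of_le_one_right hθ ?_
    rw [he, norm_smul, norm_inv, norm_norm]
    exact inv_mul_le_one
  have hinner : inner ℝ a y - inner ℝ a y' = θ * ‖y - y'‖ := by
    rw [← inner_sub_right, ha, he, inner_smul_left, inner_smul_left, real_inner_self_eq_norm_sq]
    simp only [conj_trivial]
    rcases eq_or_ne ‖y - y'‖ 0 with h | h
    · simp [h]
    · field_simp
  have hbd : ∀ {z c : E d}, z ∈ box c 1 → |inner ℝ a z - inner ℝ a c| ≤ θ * Real.sqrt d / 2 := by
    intro z c hz
    rw [← inner_sub_right]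
    refine (abs_real_inner_le_norm _ _).trans ?_
    have := norm_sub_le_of_mem_box zero_le_one hz
    calc ‖a‖ * ‖z - c‖ ≤ θ * (Real.sqrt d * (1 / 2)) := by gcongr
      _ = _ := by ring
  have hw := memLp_expWeight hΛ hb a
  set f := chiFun Λ y' g with hf
  have h1 := norm_expWeight_mul_le hw hV hE (hR f)
  have h2 : ‖chiFun Λ y (R f)‖ ≤
      Real.exp (-inner ℝ a y + θ * Real.sqrt d / 2) * ‖mulOp hw (R f)‖ := by
    refine Lp.norm_le_mul_norm_of_ae_le_mul ?_
    filter_upwards [chiFun_coe Λ y (R f), mulOp_coe hw (R f)] with z k1 k2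
    rw [k1, k2, norm_mul, Complex.norm_real, expWeight, Real.norm_eq_abs,
      abs_of_pos (Real.exp_pos _), ← mul_assoc, ← Real.exp_add]
    by_cases hz : z ∈ box y 1
    · rw [indicator_of_mem hz]
      refine le_mul_of_one_le_left (norm_nonneg _) (Real.one_le_exp ?_)
      have := (abs_le.1 (hbd hz)).1
      linarith
    · rw [indicator_of_notMem hz, norm_zero]
      positivity
  have h3 : ‖mulOp hw f‖ ≤ Real.exp (inner ℝ a y' + θ * Real.sqrt d / 2) * ‖g‖ := by
    refine Lp.norm_le_mul_norm_of_ae_le_mul ?_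
    filter_upwards [chiFun_coe Λ y' g, mulOp_coe hw f] with z k1 k2
    rw [k2, hf, k1, norm_mul, Complex.norm_real, expWeight, Real.norm_eq_abs,
      abs_of_pos (Real.exp_pos _)]
    by_cases hz : z ∈ box y' 1
    · rw [indicator_of_mem hz]
      gcongr
      have := (abs_le.1 (hbd hz)).2
      linarith
    · rw [indicator_of_notMem hz, norm_zero, mul_zero]
      positivity
  have h4 : ‖mulOp hw (R f)‖ ≤ 2 / E₀ * ‖mulOp hw f‖ := by
    have h5 : E₀ / 2 ≤ E₀ - Eₙ - ‖a‖ ^ 2 := by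
      have : ‖a‖ ^ 2 ≤ θ ^ 2 := by gcongr
      linarith
    have h6 : E₀ / 2 * ‖mulOp hw (R f)‖ ≤ ‖mulOp hw f‖ :=
      (mul_le_mul_of_nonneg_right h5 (norm_nonneg _)).trans h1
    calc ‖mulOp hw (R f)‖ = 2 / E₀ * (E₀ / 2 * ‖mulOp hw (R f)‖) := by field_simp
      _ ≤ _ := by gcongr
  change ‖chiFun Λ y (R f)‖ ≤ _
  calc ‖chiFun Λ y (R f)‖
      ≤ Real.exp (-inner ℝ a y + θ * Real.sqrt d / 2) *
        (2 / E₀ * (Real.exp (inner ℝ a y' + θ * Real.sqrt d / 2) * ‖g‖)) := by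
        refine h2.trans ?_
        gcongr
        exact h4.trans (by gcongr)
    _ = 2 / E₀ * (Real.exp (-inner ℝ a y + θ * Real.sqrt d / 2) *
        Real.exp (inner ℝ a y' + θ * Real.sqrt d / 2)) * ‖g‖ := by ring
    _ = 2 / E₀ * (Real.exp (θ * Real.sqrt d) * Real.exp (-θ * ‖y - y'‖)) * ‖g‖ := by
        rw [← Real.exp_add, ← Real.exp_add]
        congr 3
        linarith
    _ = _ := by ring

theorem norm_resolvent_le {Λ : Set (E d)} {V : E d → ℝ} (hΛ : MeasurableSet Λ)
    (hb : Bornology.IsBounded Λ) (hV : MemLp (fun y => (V y : ℂ)) ∞ (volume.restrict Λ))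
    {E₀ Eₙ : ℝ} (hE : FormBound hV E₀) {φ f : L2 Λ}
    (h : (φ, f + (Eₙ : ℂ) • φ) ∈ schrodinger Λ V) : (E₀ - Eₙ) * ‖φ‖ ≤ ‖f‖ := by
  have hw := memLp_expWeight hΛ hb (0 : E d)
  have h1 := norm_expWeight_mul_le hw hV hE h
  have h2 : ∀ g : L2 Λ, mulOp hw g = g := fun g => by
    refine Lp.ext ?_
    filter_upwards [mulOp_coe hw g] with z hz
    rw [hz]
    simp [expWeight]
  simpa [h2] using h1

theorem schrodinger_sub {Λ : Set (E d)} {V : E d → ℝ}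
    (hV : MemLp (fun y => (V y : ℂ)) ∞ (volume.restrict Λ)) {φ f φ' f' : L2 Λ}
    (h : (φ, f) ∈ schrodinger Λ V) (h' : (φ', f') ∈ schrodinger Λ V) :
    (φ - φ', f - f') ∈ schrodinger Λ V := by
  rw [mem_schrodinger_iff hV] at h h' ⊢
  obtain ⟨G, hG, hq⟩ := h
  obtain ⟨G', hG', hq'⟩ := h'
  refine ⟨G - G', (testSubmodule Λ).topologicalClosure.sub_mem hG hG', fun q hqm => ?_⟩
  have e1 := hq q hqm
  have e2 := hq' q hqm
  dsimp only at e1 e2 ⊢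
  simp only [Pi.sub_apply, inner_sub_right, Finset.sum_sub_distrib, map_sub] at e1 e2 ⊢
  rw [e1, e2]
  ring

/-- A box is good as soon as the points of `B` are relatively dense in it. -/
theorem isGoodBox_of_relDense (u : SingleSite d) {α L Eₙ m E₀ θ ρ : ℝ} {x : E d}
    {B S : Set (E d)} (hBS : Disjoint B S) (hB : B.Finite) (hS : S.Finite) (hBΛ : B ⊆ box x L)
    (hSΛ : S ⊆ box x L) (hρ : 0 ≤ ρ) (hdense : ∀ y ∈ box x L, ∃ ζ ∈ B, ∀ i, |y i - ζ i| ≤ ρ)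
    (h0 : 0 < E₀) (hE₀ : E₀ * ((4 * ρ / u.deltaMinus + 5) ^ d *
      (2 / u.uMinus + 2 * (d * (ρ + u.deltaMinus) ^ 2))) ≤ 1)
    (hEn : 4 * Eₙ ≤ E₀) (hθ : 0 ≤ θ) (hθE : 4 * θ ^ 2 ≤ E₀)
    (hnorm : 2 / E₀ ≤ Real.exp (L ^ (1 - α)))
    (hdecay : ∀ s, L / 10 ≤ s →
      2 / E₀ * Real.exp (θ * Real.sqrt d) * Real.exp (-θ * s) ≤ Real.exp (-m * s)) :
    IsGoodBox u α x L B S Eₙ m := by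
  refine ⟨hBS, fun t ht => ?_⟩
  have hV := memLp_potential u hB hS hBΛ hSΛ t
  have hE : FormBound hV E₀ := formBound_of_relDense u hB hS hBΛ hSΛ ht hρ hdense h0.le hE₀
  have hΛ := measurableSet_box x L
  have hb := isBounded_box x L
  have hV0 : ∀ᵐ y ∂((volume : Measure (E d)).restrict (box x L)),
      0 ≤ potential u (box x L) B S t y := by
    filter_upwards [indicator_le_potential u hB hS hBΛ hSΛ ht] with y hy
    exact (indicator_nonneg (fun _ _ => u.uMinus_pos.le) y).trans hy
  obtain ⟨R, hR⟩ := exists_resolvent hV h0 hE hV0 hEn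
  refine ⟨R, fun φ f => ⟨fun h => ?_, fun h => h ▸ hR f⟩, ?_, fun y _ y' _ hyy => ?_⟩
  · have h1 := schrodinger_sub hV h (hR f)
    rw [add_sub_add_left_eq_sub, ← smul_sub] at h1
    have h2 := norm_resolvent_le hΛ hb hV hE (φ := φ - R f) (f := 0) (by rwa [zero_add])
    rw [norm_zero] at h2
    have h3 : ‖φ - R f‖ ≤ 0 := by
      by_contra h4
      have : 0 < (E₀ - Eₙ) * ‖φ - R f‖ := mul_pos (by linarith) (not_le.1 h4)
      linarith
    exact sub_eq_zero.1 (norm_le_zero_iff.1 h3)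
  · refine le_trans (ContinuousLinearMap.opNorm_le_bound _ (by positivity) fun f => ?_) hnorm
    have h1 := norm_resolvent_le hΛ hb hV hE (hR f)
    have h2 : E₀ / 2 * ‖R f‖ ≤ ‖f‖ :=
      (mul_le_mul_of_nonneg_right (by linarith) (norm_nonneg _)).trans h1
    calc ‖R f‖ = 2 / E₀ * (E₀ / 2 * ‖R f‖) := by field_simp
      _ ≤ _ := by gcongr
  · exact (norm_chi_comp_le hΛ hb hV hθ hE (by linarith) h0 hR y y').trans (hdecay _ hyy)

end PoissonHam

namespace PoissonHam

/-! ### Poisson estimates -/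

section Poisson

variable {Ω : Type*} [MeasurableSpace Ω] {P : Measure Ω}

/-- The random number `N` of points is Poisson distributed with mean `l`. -/
structure IsPoissonCount (N : Ω → ℕ∞) (l : ℝ) (P : Measure Ω) : Prop where
  measurable : Measurable N
  nonneg : 0 ≤ l
  law : ∀ k : ℕ, P {ω | N ω = k} = ENNReal.ofReal (l ^ k / (k.factorial : ℝ) * Real.exp (-l))

namespace IsPoissonCount

variable {N : Ω → ℕ∞} {l : ℝ}

theorem measurableSet_eq (h : IsPoissonCount N l P) (k : ℕ∞) : MeasurableSet {ω | N ω = k} :=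
  h.measurable (measurableSet_singleton k)

theorem prob_eq_zero (h : IsPoissonCount N l P) : P {ω | N ω = 0} = ENNReal.ofReal (Real.exp (-l)) := by
  simpa using h.law 0

theorem prob_ne_zero_le [IsProbabilityMeasure P] (h : IsPoissonCount N l P) :
    P {ω | N ω ≠ 0} ≤ ENNReal.ofReal l := by
  have h1 : {ω | N ω ≠ 0} = {ω | N ω = 0}ᶜ := rfl
  rw [h1, prob_compl_eq_one_sub (h.measurableSet_eq 0), h.prob_eq_zero, ← ENNReal.ofReal_one,
    ← ENNReal.ofReal_sub _ (Real.exp_pos _).le]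
  refine ENNReal.ofReal_le_ofReal ?_
  linarith [Real.add_one_le_exp (-l)]

theorem prob_not_le_one_le [IsProbabilityMeasure P] (h : IsPoissonCount N l P) :
    P {ω | ¬ N ω ≤ 1} ≤ ENNReal.ofReal (l ^ 2) := by
  have h1 : {ω | ¬ N ω ≤ 1} = ({ω | N ω = 0} ∪ {ω | N ω = 1})ᶜ := by
    ext ω
    simp only [mem_ofPred_eq, mem_compl_iff, mem_union, Order.le_one_iff]
  have h2 : Disjoint {ω | N ω = 0} {ω | N ω = 1} := by
    refine disjoint_left.2 fun ω h0 h1 => ?_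
    simp only [mem_ofPred_eq] at h0 h1
    rw [h0] at h1
    exact zero_ne_one h1
  have h3 : P {ω | N ω = 1} = ENNReal.ofReal (l * Real.exp (-l)) := by simpa using h.law 1
  rw [h1, prob_compl_eq_one_sub ((h.measurableSet_eq 0).union (h.measurableSet_eq 1)),
    measure_union h2 (h.measurableSet_eq 1), h.prob_eq_zero, h3,
    ← ENNReal.ofReal_add (Real.exp_pos _).le (mul_nonneg h.nonneg (Real.exp_pos _).le),
    ← ENNReal.ofReal_one, ← ENNReal.ofReal_sub _
      (add_nonneg (Real.exp_pos _).le (mul_nonneg h.nonneg (Real.exp_pos _).le))]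
  refine ENNReal.ofReal_le_ofReal ?_
  nlinarith [Real.add_one_le_exp (-l), h.nonneg]

theorem hasSum_pow_div_factorial (l : ℝ) :
    HasSum (fun k : ℕ => l ^ k / (k.factorial : ℝ)) (Real.exp l) := by
  rw [Real.exp_eq_exp_ℝ]
  exact NormedSpace.expSeries_div_hasSum_exp l

theorem prob_eq_top [IsProbabilityMeasure P] (h : IsPoissonCount N l P) :
    P {ω | N ω = ⊤} = 0 := by
  have h1 : {ω | N ω = ⊤} = (⋃ k : ℕ, {ω | N ω = k})ᶜ := by
    ext ω
    simp only [mem_ofPred_eq, mem_compl_iff, mem_iUnion, not_exists]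
    constructor
    · intro h k hk
      rw [h] at hk
      exact ENat.top_ne_natCast k hk
    · intro h
      by_contra h0
      obtain ⟨k, hk⟩ := ENat.ne_top_iff_exists.1 h0
      exact h k hk.symm
  have hd : Pairwise (Function.onFun Disjoint fun k : ℕ => {ω | N ω = k}) := by
    intro i j hij
    refine disjoint_left.2 fun ω h0 h1 => hij ?_
    simp only [mem_ofPred_eq] at h0 h1
    exact_mod_cast h0.symm.trans h1
  have h2 : ∑' k : ℕ, P {ω | N ω = k} = 1 := by
    have hs := (hasSum_pow_div_factorial l).mul_right (Real.exp (-l))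
    rw [tsum_congr h.law, ← ENNReal.ofReal_tsum_of_nonneg _ hs.summable, hs.tsum_eq,
      ← Real.exp_add, add_neg_cancel, Real.exp_zero, ENNReal.ofReal_one]
    intro k
    have := h.nonneg
    positivity
  rw [h1, prob_compl_eq_one_sub (MeasurableSet.iUnion fun k : ℕ => h.measurableSet_eq k),
    measure_iUnion hd (fun k : ℕ => h.measurableSet_eq k), h2, tsub_self]

/-- A Chernoff bound: a Poisson variable exceeds eight times its mean with exponentially small
probability. -/
theorem prob_ge_le [IsProbabilityMeasure P] (h : IsPoissonCount N l P) :
    P {ω | ENNReal.ofReal (8 * l) ≤ (N ω : ℝ≥0∞)} ≤ ENNReal.ofReal (Real.exp (-(6 * l))) := by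
  have hl := h.nonneg
  have h1 : {ω | ENNReal.ofReal (8 * l) ≤ (N ω : ℝ≥0∞)} ⊆
      {ω | N ω = ⊤} ∪ ⋃ k : ℕ, {ω | N ω = k ∧ 8 * l ≤ k} := by
    intro ω hω
    rcases eq_or_ne (N ω) ⊤ with h0 | h0
    · exact Or.inl h0
    · obtain ⟨k, hk⟩ := ENat.ne_top_iff_exists.1 h0
      refine Or.inr (mem_iUnion.2 ⟨k, hk.symm, ?_⟩)
      simp only [mem_ofPred_eq, ← hk, ENat.toENNReal_coe] at hω
      rw [← ENNReal.ofReal_natCast] at hω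
      exact (ENNReal.ofReal_le_ofReal_iff (Nat.cast_nonneg k)).1 hω
  have hs := (hasSum_pow_div_factorial (Real.exp 1 * l)).mul_right (Real.exp (-(9 * l)))
  have h2 : ∀ k : ℕ, P {ω | N ω = k ∧ 8 * l ≤ k} ≤
      ENNReal.ofReal ((Real.exp 1 * l) ^ k / (k.factorial : ℝ) * Real.exp (-(9 * l))) := by
    intro k
    by_cases hk : 8 * l ≤ k
    · simp only [hk, and_true]
      rw [h.law]
      refine ENNReal.ofReal_le_ofReal ?_
      have h3 : Real.exp (-l) ≤ Real.exp 1 ^ k * Real.exp (-(9 * l)) := by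
        rw [← Real.exp_nat_mul, ← Real.exp_add]
        refine Real.exp_le_exp.2 ?_
        linarith
      calc l ^ k / (k.factorial : ℝ) * Real.exp (-l)
          ≤ l ^ k / (k.factorial : ℝ) * (Real.exp 1 ^ k * Real.exp (-(9 * l))) := by gcongr
        _ = _ := by rw [mul_pow]; ring
    · simp [hk]
  calc P {ω | ENNReal.ofReal (8 * l) ≤ (N ω : ℝ≥0∞)}
      ≤ P {ω | N ω = ⊤} + ∑' k : ℕ, P {ω | N ω = k ∧ 8 * l ≤ k} :=
        (measure_mono h1).trans ((measure_union_le _ _).trans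
          (add_le_add_right (measure_iUnion_le _) _))
    _ ≤ 0 + ∑' k : ℕ, ENNReal.ofReal
          ((Real.exp 1 * l) ^ k / (k.factorial : ℝ) * Real.exp (-(9 * l))) := by
        rw [h.prob_eq_top]
        exact add_le_add_right (ENNReal.tsum_le_tsum h2) _
    _ = ENNReal.ofReal (Real.exp (Real.exp 1 * l) * Real.exp (-(9 * l))) := by
        rw [zero_add, ← ENNReal.ofReal_tsum_of_nonneg (fun k => by positivity) hs.summable,
          hs.tsum_eq]
    _ ≤ _ := by
        rw [← Real.exp_add]
        refine ENNReal.ofReal_le_ofReal (Real.exp_le_exp.2 ?_)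
        nlinarith [Real.exp_one_lt_d9]

end IsPoissonCount

theorem count_marked {d : ℕ} (Z A : Set (E d)) (m : E d → Bool) (T : Set Bool) :
    count {q : E d × Bool | q.1 ∈ Z ∧ q.2 = m q.1} (A ×ˢ T) = count {ζ | ζ ∈ Z ∧ m ζ ∈ T} A := by
  have h : {q : E d × Bool | q.1 ∈ Z ∧ q.2 = m q.1} ∩ (A ×ˢ T) =
      (fun ζ => (ζ, m ζ)) '' ({ζ | ζ ∈ Z ∧ m ζ ∈ T} ∩ A) := by
    ext ⟨ζ, b⟩
    simp only [mem_inter_iff, mem_ofPred_eq, mem_prod, mem_image, Prod.mk.injEq]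
    constructor
    · rintro ⟨⟨h1, h2⟩, h3, h4⟩
      exact ⟨ζ, ⟨⟨h1, h2 ▸ h4⟩, h3⟩, rfl, h2.symm⟩
    · rintro ⟨ζ', ⟨⟨h1, h2⟩, h3⟩, rfl, rfl⟩
      exact ⟨⟨h1, rfl⟩, h3, h2⟩
  rw [count, count, h]
  refine Function.Injective.encard_image (fun a b hab => ?_) _
  exact (Prod.mk.inj hab).1

namespace MarkedPoissonProcess

variable {d : ℕ} {ϱ : ℝ} (M : MarkedPoissonProcess d ϱ P)

theorem X_subset_Y (ω : Ω) : M.X ω ⊆ M.Y ω := fun _ h => h.1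

theorem X'_subset_Y (ω : Ω) : M.X' ω ⊆ M.Y ω := fun _ h => h.1

theorem countable_Y (ω : Ω) : (M.Y ω).Countable := by
  have h := (M.isPoisson.countable ω).image Prod.fst
  refine h.mono fun ζ hζ => ?_
  exact ⟨(ζ, M.mark ω ζ), ⟨hζ, rfl⟩, rfl⟩

/-- The points of `Y` with a mark in `T` form a Poisson process of density `ϱ · #T`. -/
theorem isPoissonCount_of_marks (hϱ : 0 ≤ ϱ) {A : Set (E d)} (hA : MeasurableSet A)
    (hfin : volume A ≠ ∞) (T : Set Bool) {c : ℝ} (hc : 0 ≤ c)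
    (hT : Measure.count T = ENNReal.ofReal c) :
    IsPoissonCount (fun ω => count {ζ | ζ ∈ M.Y ω ∧ M.mark ω ζ ∈ T} A)
      (c * ϱ * (volume A).toReal) P := by
  have hAT : MeasurableSet (A ×ˢ T) := hA.prod (MeasurableSet.of_discrete)
  have hν : (ENNReal.ofReal (2 * ϱ) • markedVolume d) (A ×ˢ T) =
      ENNReal.ofReal (c * ϱ * (volume A).toReal) := by
    rw [Measure.smul_apply, markedVolume, Measure.prod_prod, Measure.smul_apply, smul_eq_mul,
      smul_eq_mul, hT, ENNReal.ofReal_mul (by norm_num), ENNReal.ofReal_mul (by positivity),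
      ENNReal.ofReal_mul hc, ENNReal.ofReal_toReal hfin, ENNReal.ofReal_ofNat]
    calc 2 * ENNReal.ofReal ϱ * (volume A * (2⁻¹ * ENNReal.ofReal c))
        = (2 * 2⁻¹) * (ENNReal.ofReal c * ENNReal.ofReal ϱ * volume A) := by ring
      _ = _ := by rw [ENNReal.mul_inv_cancel (by norm_num) (by norm_num), one_mul]
  have h0 : 0 ≤ c * ϱ * (volume A).toReal := by positivity
  have hcount := fun ω => count_marked (M.Y ω) A (M.mark ω) T
  refine ⟨?_, h0, fun k => ?_⟩
  · simp only [← hcount]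
    exact M.isPoisson.measurable _ hAT
  · simp only [← hcount]
    have := M.isPoisson.law _ hAT (by rw [hν]; exact ENNReal.ofReal_lt_top) k
    rwa [hν, ENNReal.toReal_ofReal h0] at this

theorem isPoissonCount_Y (hϱ : 0 ≤ ϱ) {A : Set (E d)} (hA : MeasurableSet A)
    (hfin : volume A ≠ ∞) :
    IsPoissonCount (fun ω => count (M.Y ω) A) (2 * ϱ * (volume A).toReal) P := by
  have := M.isPoissonCount_of_marks hϱ hA hfin univ (c := 2) (by norm_num) (by
    rw [← Finset.coe_univ, Measure.count_apply_finset]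
    simp)
  simpa using this

theorem isPoissonCount_X (hϱ : 0 ≤ ϱ) {A : Set (E d)} (hA : MeasurableSet A)
    (hfin : volume A ≠ ∞) :
    IsPoissonCount (fun ω => count (M.X ω) A) (ϱ * (volume A).toReal) P := by
  have := M.isPoissonCount_of_marks hϱ hA hfin {true} (c := 1) (by norm_num) (by simp)
  simpa [MarkedPoissonProcess.X] using this

end MarkedPoissonProcess

end Poisson

end PoissonHam

namespace PoissonHam

variable {d : ℕ}

/-! ### Grids of cells -/

/-- The centre of the cell with index `n` in the grid of step `a` through `x`. -/
noncomputable def cell (x : E d) (a : ℝ) (n : Fin d → ℤ) : E d := WithLp.toLp 2 fun i => x i + a * n i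

/-- The indices of the cells of side `a` that are contained in `Λ_L(x)`. -/
def grid (x : E d) (a L : ℝ) : Set (Fin d → ℤ) := {n | box (cell x a n) a ⊆ box x L}

theorem cell_apply (x : E d) (a : ℝ) (n : Fin d → ℤ) (i : Fin d) :
    cell x a n i = x i + a * n i := rfl

theorem mem_box_self (x : E d) {s : ℝ} (hs : 0 < s) : x ∈ box x s := fun i => by
  simpa using hs

theorem box_mono (x : E d) {s s' : ℝ} (h : s ≤ s') : box x s ⊆ box x s' := fun _ hz i =>
  (hz i).trans_le (by linarith)

theorem mem_grid_of_abs_le {x : E d} {a L : ℝ} {n : Fin d → ℤ}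
    (h : ∀ i, |a * n i| ≤ (L - a) / 2) : n ∈ grid x a L :=
  box_subset_box fun i => by simpa [cell_apply] using h i

theorem abs_lt_of_mem_grid {x : E d} {a L : ℝ} (ha : 0 < a) {n : Fin d → ℤ}
    (hn : n ∈ grid x a L) (i : Fin d) : |a * n i| < L / 2 := by
  have := hn (mem_box_self _ ha) i
  simpa [cell_apply] using this

theorem eq_of_mem_box_cell {x z : E d} {a : ℝ} (ha : 0 < a) {n n' : Fin d → ℤ}
    (h : z ∈ box (cell x a n) a) (h' : z ∈ box (cell x a n') a) : n = n' := by
  ext i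
  have h1 := abs_lt.1 (h i)
  have h2 := abs_lt.1 (h' i)
  rw [cell_apply] at h1 h2
  have h3 : a * (n i - n' i : ℝ) < a * 1 := by linarith
  have h4 : a * (n' i - n i : ℝ) < a * 1 := by linarith
  have h5 := lt_of_mul_lt_mul_left h3 ha.le
  have h6 := lt_of_mul_lt_mul_left h4 ha.le
  have h7 : n i - n' i < 1 := by exact_mod_cast h5
  have h8 : n' i - n i < 1 := by exact_mod_cast h6
  omega

/-- The indices with all entries between `-N` and `N`. -/
noncomputable def indexCube (d N : ℕ) : Finset (Fin d → ℤ) := Fintype.piFinset fun _ => Finset.Icc (-(N : ℤ)) N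

theorem mem_indexCube {N : ℕ} {n : Fin d → ℤ} : n ∈ indexCube d N ↔ ∀ i, |(n i : ℝ)| ≤ N := by
  simp only [indexCube, Fintype.mem_piFinset, Finset.mem_Icc, abs_le]
  exact forall_congr' fun i => ⟨fun h => ⟨by exact_mod_cast h.1, by exact_mod_cast h.2⟩,
    fun h => ⟨by exact_mod_cast h.1, by exact_mod_cast h.2⟩⟩

theorem card_indexCube (d N : ℕ) : (indexCube d N).card = (2 * N + 1) ^ d := by
  rw [indexCube, Fintype.card_piFinset_const, Int.card_Icc]
  congr 1
  omega

theorem grid_subset_indexCube (x : E d) {a L : ℝ} (ha : 0 < a) :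
    grid x a L ⊆ indexCube d ⌊L / (2 * a)⌋₊ := by
  intro n hn
  refine Finset.mem_coe.2 (mem_indexCube.2 fun i => ?_)
  have h1 := abs_lt_of_mem_grid ha hn i
  rw [abs_mul, abs_of_pos ha] at h1
  have h2 : |(n i : ℝ)| ≤ L / (2 * a) := by
    rw [le_div_iff₀ (by positivity)]
    linarith
  have h3 : ((n i).natAbs : ℝ) = |(n i : ℝ)| := by
    rw [Nat.cast_natAbs, Int.cast_abs]
  rw [← h3] at h2 ⊢
  exact_mod_cast Nat.le_floor h2

theorem grid_finite (x : E d) {a : ℝ} (L : ℝ) (ha : 0 < a) : (grid x a L).Finite :=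
  (indexCube d _).finite_toSet.subset (grid_subset_indexCube x ha)

theorem card_grid_le (x : E d) {a L : ℝ} (ha : 0 < a) (hL : 0 ≤ L) :
    ((grid_finite x L ha).toFinset.card : ℝ) ≤ (L / a + 1) ^ d := by
  have h1 : (grid_finite x L ha).toFinset.card ≤ (2 * ⌊L / (2 * a)⌋₊ + 1) ^ d := by
    rw [← card_indexCube]
    refine Finset.card_le_card fun n hn => ?_
    exact grid_subset_indexCube x ha ((grid_finite x L ha).mem_toFinset.1 hn)
  calc _ ≤ (2 * (⌊L / (2 * a)⌋₊ : ℝ) + 1) ^ d := by exact_mod_cast h1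
    _ ≤ (2 * (L / (2 * a)) + 1) ^ d := by
        gcongr
        exact Nat.floor_le (by positivity)
    _ = _ := by congr 2; field_simp

theorem le_card_grid (x : E d) {a L : ℝ} (ha : 0 < a) (hL : 2 * a ≤ L) :
    (L / a - 2) ^ d ≤ ((grid_finite x L ha).toFinset.card : ℝ) := by
  set N := ⌊(L / a - 1) / 2⌋₊ with hN
  have h2 : 2 ≤ L / a := by rwa [le_div_iff₀ ha]
  have h1 : (2 * N + 1) ^ d ≤ (grid_finite x L ha).toFinset.card := by
    rw [← card_indexCube]
    refine Finset.card_le_card fun n hn => (grid_finite x L ha).mem_toFinset.2 ?_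
    refine mem_grid_of_abs_le fun i => ?_
    have h3 : |(n i : ℝ)| ≤ (L / a - 1) / 2 :=
      (mem_indexCube.1 hn i).trans (Nat.floor_le (by linarith))
    rw [abs_mul, abs_of_pos ha]
    calc a * |(n i : ℝ)| ≤ a * ((L / a - 1) / 2) := by gcongr
      _ = _ := by field_simp
  calc (L / a - 2) ^ d ≤ (2 * (N : ℝ) + 1) ^ d := by
        have := Nat.lt_floor_add_one ((L / a - 1) / 2)
        rw [← hN] at this
        refine pow_le_pow_left₀ (by linarith) (by linarith) d
    _ ≤ _ := by exact_mod_cast h1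

/-! ### Configurations and their labels -/

theorem eta_pos (d : ℕ) (L : ℝ) : 0 < eta d L := Real.exp_pos _

theorem lattice_eq_image (x : E d) (L : ℝ) :
    lattice x L = cell x (eta d L) '' grid x (eta d L) L := by
  ext j
  constructor
  · rintro ⟨⟨k, hk⟩, hj⟩
    have : j = cell x (eta d L) k := by
      ext i
      exact hk i
    exact ⟨k, by rwa [grid, mem_ofPred_eq, ← this], this.symm⟩
  · rintro ⟨k, hk, rfl⟩
    exact ⟨⟨k, fun _ => rfl⟩, hk⟩

theorem lattice_finite (x : E d) (L : ℝ) : (lattice x L).Finite := by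
  rw [lattice_eq_image]
  exact (grid_finite x L (eta_pos d L)).image _

theorem eq_of_mem_box_lattice {x z j j' : E d} {L : ℝ} (hj : j ∈ lattice x L)
    (hj' : j' ∈ lattice x L) (h : z ∈ box j (eta d L)) (h' : z ∈ box j' (eta d L)) : j = j' := by
  rw [lattice_eq_image] at hj hj'
  obtain ⟨k, _, rfl⟩ := hj
  obtain ⟨k', _, rfl⟩ := hj'
  rw [eq_of_mem_box_cell (eta_pos d L) h h']

theorem lattice_subset_box (x : E d) (L : ℝ) : lattice x L ⊆ box x L := fun _ hj =>
  hj.2 (mem_box_self _ (eta_pos d L))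

theorem count_mono {T : Type*} {Z Z' A A' : Set T} (h : Z ⊆ Z') (h' : A ⊆ A') :
    count Z A ≤ count Z' A' := encard_le_encard (inter_subset_inter h h')

theorem count_ne_zero_iff {T : Type*} {Z A : Set T} : count Z A ≠ 0 ↔ ∃ p ∈ Z, p ∈ A := by
  rw [count, Ne, encard_eq_zero, ← Ne, ← nonempty_iff_ne_empty]
  rfl

/-- The lattice points whose boxes of side `η_L` are occupied by the configuration `Z`. -/
def label (x : E d) (L : ℝ) (Z : Set (E d)) : Set (E d) :=
  {j | j ∈ lattice x L ∧ count Z (box j (eta d L)) ≠ 0}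

theorem label_subset_lattice (x : E d) (L : ℝ) (Z : Set (E d)) : label x L Z ⊆ lattice x L :=
  fun _ h => h.1

theorem label_mono (x : E d) (L : ℝ) {Z Z' : Set (E d)} (h : Z ⊆ Z') :
    label x L Z ⊆ label x L Z' := fun j hj => by
  obtain ⟨p, hp, hpj⟩ := count_ne_zero_iff.1 hj.2
  exact ⟨hj.1, count_ne_zero_iff.2 ⟨p, h hp, hpj⟩⟩

theorem label_union (x : E d) (L : ℝ) (Z Z' : Set (E d)) :
    label x L (Z ∪ Z') = label x L Z ∪ label x L Z' := by
  ext j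
  constructor
  · rintro ⟨hj, h⟩
    obtain ⟨p, hp | hp, hpj⟩ := count_ne_zero_iff.1 h
    · exact Or.inl ⟨hj, count_ne_zero_iff.2 ⟨p, hp, hpj⟩⟩
    · exact Or.inr ⟨hj, count_ne_zero_iff.2 ⟨p, hp, hpj⟩⟩
  · rintro (h | h)
    · exact label_mono x L subset_union_left h
    · exact label_mono x L subset_union_right h

/-- A set of lattice points is its own label. -/
theorem label_eq_self {x : E d} {L : ℝ} {J : Set (E d)} (hJ : J ⊆ lattice x L) :
    label x L J = J := by
  ext j
  constructor
  · rintro ⟨hj, h⟩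
    obtain ⟨p, hp, hpj⟩ := count_ne_zero_iff.1 h
    rwa [← eq_of_mem_box_lattice (hJ hp) hj (mem_box_self p (eta_pos d L)) hpj]
  · exact fun hj => ⟨hJ hj, count_ne_zero_iff.2 ⟨j, hj, mem_box_self j (eta_pos d L)⟩⟩

theorem count_le_one_of_subset_lattice {x : E d} {L : ℝ} {J : Set (E d)} (hJ : J ⊆ lattice x L)
    {j : E d} (hj : j ∈ lattice x L) : count J (box j (eta d L)) ≤ 1 := by
  refine encard_le_one_iff.2 fun a b ha hb => ?_
  rw [eq_of_mem_box_lattice (hJ ha.1) hj (mem_box_self a (eta_pos d L)) ha.2,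
    eq_of_mem_box_lattice (hJ hb.1) hj (mem_box_self b (eta_pos d L)) hb.2]

theorem eq_of_le_one {a b : ℕ∞} (ha : a ≤ 1) (hb : b ≤ 1) (h : a ≠ 0 ↔ b ≠ 0) : a = b := by
  rcases Order.le_one_iff.1 ha with rfl | rfl <;> rcases Order.le_one_iff.1 hb with rfl | rfl <;>
    simp_all

/-- The equivalence class of an acceptable configuration is given by its label. -/
theorem mem_eqClass_iff {ϱ : ℝ} {x : E d} {L : ℝ} {J Z : Set (E d)} (hJ : J ⊆ lattice x L) :
    Z ∈ eqClass ϱ x L J ↔ Z ∈ acceptable ϱ x L ∧ label x L Z = J := by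
  constructor
  · rintro ⟨hZ, h⟩
    refine ⟨hZ, ?_⟩
    rw [← label_eq_self hJ]
    ext j
    exact and_congr_right fun hj => by rw [h j hj]
  · rintro ⟨hZ, h⟩
    refine ⟨hZ, fun j hj => eq_of_le_one (hZ.2.2.1 j hj)
      (count_le_one_of_subset_lattice hJ hj) ?_⟩
    have h1 : j ∈ label x L Z ↔ j ∈ label x L J := by rw [h, label_eq_self hJ]
    simpa only [label, mem_ofPred_eq, hj, true_and] using h1

theorem acceptable_of_subset {ϱ : ℝ} {x : E d} {L : ℝ} {Z Z' : Set (E d)} (h : Z ⊆ Z')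
    (hZ : Z' ∈ acceptable ϱ x L) : Z ∈ acceptable ϱ x L := by
  obtain ⟨h1, h2, h3, h4⟩ := hZ
  refine ⟨h1.mono h, lt_of_le_of_lt ?_ h2, fun j hj => (count_mono h subset_rfl).trans (h3 j hj), ?_⟩
  · exact ENat.toENNReal_le.2 (count_mono h subset_rfl)
  · exact le_antisymm (h4 ▸ count_mono h subset_rfl) zero_le

theorem disjoint_label {ϱ : ℝ} {x : E d} {L : ℝ} {Z Z' : Set (E d)}
    (hacc : Z ∪ Z' ∈ acceptable ϱ x L) (h : Disjoint Z Z') :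
    Disjoint (label x L Z) (label x L Z') := by
  refine disjoint_left.2 fun j hj hj' => ?_
  obtain ⟨p, hp, hpj⟩ := count_ne_zero_iff.1 hj.2
  obtain ⟨p', hp', hpj'⟩ := count_ne_zero_iff.1 hj'.2
  have h1 := encard_le_one_iff.1 (hacc.2.2.1 j hj.1) p p' ⟨Or.inl hp, hpj⟩ ⟨Or.inr hp', hpj'⟩
  exact disjoint_left.1 h hp (h1 ▸ hp')

theorem encard_label_le (x : E d) (L : ℝ) (Z : Set (E d)) :
    (label x L Z).encard ≤ count Z (box x L) := by
  have h : ∀ j : label x L Z, ∃ p ∈ Z, p ∈ box (j : E d) (eta d L) := fun j =>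
    count_ne_zero_iff.1 j.2.2
  choose g hg1 hg2 using h
  have hinj : Function.Injective g := fun j j' hjj => Subtype.ext
    (eq_of_mem_box_lattice j.2.1 j'.2.1 (hg2 j) (hjj ▸ hg2 j'))
  calc (label x L Z).encard ≤ (range g).encard := hinj.encard_range
    _ ≤ _ := encard_le_encard (by
      rintro _ ⟨j, rfl⟩
      exact ⟨hg1 j, j.2.1.2 (hg2 j)⟩)

theorem label_mem_latticeConfigs {ϱ : ℝ} {x : E d} {L : ℝ} {Z : Set (E d)}
    (hZ : Z ∈ acceptable ϱ x L) : label x L Z ∈ latticeConfigs ϱ x L :=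
  ⟨label_subset_lattice x L Z,
    (ENat.toENNReal_le.2 (encard_label_le x L Z)).trans_lt hZ.2.1⟩

/-! ### The decomposition of a configuration -/

/-- The union of the cells of side `l` whose index has only odd entries. The points of the
configuration in this region are the free sites. -/
def oddRegion (x : E d) (l : ℝ) : Set (E d) :=
  {z | ∃ k : Fin d → ℤ, z ∈ box (cell x l fun i => 2 * k i + 1) l}

theorem notMem_oddRegion (hd : 0 < d) {x z : E d} {l : ℝ} (hl : 0 < l) {k : Fin d → ℤ}
    (h : z ∈ box (cell x l fun i => 2 * k i) l) : z ∉ oddRegion x l := by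
  rintro ⟨k', h'⟩
  have := congrFun (eq_of_mem_box_cell hl h h') ⟨0, hd⟩
  omega

/-- A configuration with a point in the concentric box of side `l - 1` of each cell of side `l`. -/
def OccupiesCells (x : E d) (l L : ℝ) (Z : Set (E d)) : Prop :=
  ∀ n ∈ grid x l L, count Z (box (cell x l n) (l - 1)) ≠ 0

theorem eta_lt_one (d : ℕ) {L : ℝ} (hL : 0 < L) : eta d L < 1 := by
  rw [eta, Real.exp_lt_one_iff]
  have : 0 < L ^ (10 ^ 6 * d) := pow_pos hL _
  linarith

/-- Every cell contains a label of a configuration that occupies the cells. -/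
theorem exists_label_mem_cell {ϱ : ℝ} {x : E d} {l L : ℝ} (hL : 0 < L) {Z : Set (E d)}
    (hacc : Z ∈ acceptable ϱ x L) (hZ : OccupiesCells x l L Z) {n : Fin d → ℤ}
    (hn : n ∈ grid x l L) : ∃ j ∈ label x L Z, j ∈ box (cell x l n) l := by
  obtain ⟨p, hp, hpn⟩ := count_ne_zero_iff.1 (hZ n hn)
  have hpL : p ∈ box x L := hn (box_mono _ (by linarith) hpn)
  have hη := eta_pos d L
  have hη1 := eta_lt_one d hL
  have h1 : p ∈ ⋃ j ∈ lattice x L, box j (eta d L * (1 - eta d L)) := by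
    by_contra h0
    have h2 : p ∈ box x L \ ⋃ j ∈ lattice x L, box j (eta d L * (1 - eta d L)) := ⟨hpL, h0⟩
    exact count_ne_zero_iff.2 ⟨p, hp, h2⟩ hacc.2.2.2
  obtain ⟨j, hj, hpj⟩ := mem_iUnion₂.1 h1
  have hpj' : p ∈ box j (eta d L) := box_mono _ (by nlinarith) hpj
  refine ⟨j, ⟨hj, count_ne_zero_iff.2 ⟨p, hp, hpj'⟩⟩, fun i => ?_⟩
  have h2 := abs_lt.1 (hpj' i)
  have h3 := abs_lt.1 (hpn i)
  exact abs_lt.2 ⟨by linarith, by linarith⟩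

theorem exists_even_cell {x y : E d} {l L : ℝ} (hl : 0 < l) (hL : 4 * l ≤ L) (hy : y ∈ box x L) :
    ∃ k : Fin d → ℤ, (fun i => 2 * k i) ∈ grid x l L ∧
      ∀ z ∈ box (cell x l fun i => 2 * k i) l, ∀ i, |y i - z i| ≤ 4 * l := by
  have hL0 : 0 < L := by linarith
  -- shrinking towards the centre before rounding keeps the cell inside the box
  set c := 1 - 4 * l / L with hc
  have hc0 : 0 ≤ c := by
    have : 4 * l / L ≤ 1 := (div_le_one hL0).2 hL
    linarith
  let k : Fin d → ℤ := fun i => round ((y i - x i) * c / (2 * l))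
  have h1 : ∀ i, |(y i - x i) * c - l * (2 * k i)| ≤ l := by
    intro i
    have h2 := abs_sub_round ((y i - x i) * c / (2 * l))
    have h3 : (y i - x i) * c - l * (2 * k i) =
        2 * l * ((y i - x i) * c / (2 * l) - round ((y i - x i) * c / (2 * l))) := by
      simp only [k]
      field_simp
    rw [h3, abs_mul, abs_of_pos (show 0 < 2 * l by positivity)]
    nlinarith
  have h4 : ∀ i, |(y i - x i) * (1 - c)| ≤ 2 * l := by
    intro i
    have h5 : 1 - c = 4 * l / L := by rw [hc]; ring
    rw [abs_mul, h5, abs_of_nonneg (show 0 ≤ 4 * l / L by positivity)]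
    calc |y i - x i| * (4 * l / L) ≤ L / 2 * (4 * l / L) := by gcongr; exact (hy i).le
      _ = 2 * l := by field_simp; ring
  have h6 : ∀ i, |(y i - x i) * c| ≤ L / 2 - 2 * l := by
    intro i
    rw [abs_mul, abs_of_nonneg hc0]
    calc |y i - x i| * c ≤ L / 2 * c := by gcongr; exact (hy i).le
      _ = L / 2 - 2 * l := by rw [hc]; field_simp; ring
  refine ⟨k, mem_grid_of_abs_le fun i => ?_, fun z hz i => ?_⟩
  · have a1 := abs_le.1 (h1 i)
    have a2 := abs_le.1 (h6 i)
    push_cast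
    exact abs_le.2 ⟨by linarith, by linarith⟩
  · have a1 := abs_le.1 (h1 i)
    have a2 := abs_le.1 (h4 i)
    have a3 := abs_lt.1 (hz i)
    rw [cell_apply] at a3
    push_cast at a3
    exact abs_le.2 ⟨by linarith, by linarith⟩

/-- The labels outside of the odd region are relatively dense. -/
theorem label_diff_relDense {ϱ : ℝ} (hd : 0 < d) {x : E d} {l L : ℝ} (hl : 0 < l)
    (hL : 4 * l ≤ L) {Z : Set (E d)} (hacc : Z ∈ acceptable ϱ x L) (hZ : OccupiesCells x l L Z)
    {y : E d} (hy : y ∈ box x L) :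
    ∃ ζ ∈ label x L Z \ oddRegion x l, ∀ i, |y i - ζ i| ≤ 4 * l := by
  obtain ⟨k, hk, h⟩ := exists_even_cell hl hL hy
  obtain ⟨j, hj, hjk⟩ := exists_label_mem_cell (by linarith) hacc hZ hk
  exact ⟨j, ⟨hj, notMem_oddRegion hd hl hjk⟩, h j hjk⟩

/-- A box that contains `(2N+1)^d` odd cells contains at least as many free sites. -/
theorem le_count_label_inter {ϱ : ℝ} {x y : E d} {l L s : ℝ} (hl : 0 < l) (hL : 0 < L)
    {Z : Set (E d)} (hacc : Z ∈ acceptable ϱ x L) (hZ : OccupiesCells x l L Z)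
    (hy : box y s ⊆ box x L) {N : ℕ} (hN : l * (4 * N + 3) ≤ s) :
    (((2 * N + 1) ^ d : ℕ) : ℕ∞) ≤ count (label x L Z ∩ oddRegion x l) (box y s) := by
  let k₀ : Fin d → ℤ := fun i => round ((y i - x i - l) / (2 * l))
  have h0 : ∀ r ∈ indexCube d N,
      box (cell x l fun i => 2 * (k₀ i + r i) + 1) l ⊆ box y s := by
    intro r hr
    refine box_subset_box fun i => ?_
    have h2 := abs_sub_round ((y i - x i - l) / (2 * l))
    have h3 : y i - x i - l - l * (2 * k₀ i) =
        2 * l * ((y i - x i - l) / (2 * l) - round ((y i - x i - l) / (2 * l))) := by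
      simp only [k₀]
      field_simp
    have h4 : |y i - x i - l - l * (2 * k₀ i)| ≤ l := by
      rw [h3, abs_mul, abs_of_pos (show 0 < 2 * l by positivity)]
      nlinarith
    have h5 : |2 * l * r i| ≤ 2 * l * N := by
      rw [abs_mul, abs_of_pos (show 0 < 2 * l by positivity)]
      gcongr
      exact mem_indexCube.1 hr i
    have a1 := abs_le.1 h4
    have a2 := abs_le.1 h5
    rw [cell_apply]
    push_cast
    exact abs_le.2 ⟨by linarith, by linarith⟩
  have h1 : ∀ r : indexCube d N, ∃ j ∈ label x L Z,
      j ∈ box (cell x l fun i => 2 * (k₀ i + (r : Fin d → ℤ) i) + 1) l := fun r =>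
    exists_label_mem_cell hL hacc hZ ((h0 r r.2).trans hy)
  choose g hg1 hg2 using h1
  have hinj : Function.Injective g := by
    intro r r' hrr
    have h2 := eq_of_mem_box_cell hl (hg2 r) (hrr ▸ hg2 r')
    refine Subtype.ext (funext fun i => ?_)
    have := congrFun h2 i
    omega
  calc (((2 * N + 1) ^ d : ℕ) : ℕ∞) = ENat.card (indexCube d N) := by
        rw [ENat.card_eq_coe_fintype_card, Fintype.card_coe, card_indexCube]
    _ ≤ (range g).encard := hinj.encard_range
    _ ≤ _ := encard_le_encard (by
        rintro _ ⟨r, rfl⟩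
        exact ⟨⟨hg1 r, _, hg2 r⟩, h0 r r.2 (hg2 r)⟩)

/-! ### The localized event -/

section Event

variable {ϱ : ℝ} {Ω : Type*} [MeasurableSpace Ω] {P : Measure Ω}

theorem mem_bevent_iff (M : MarkedPoissonProcess d ϱ P) {x : E d} {L : ℝ} {B B' S : Set (E d)}
    (h : B ∪ B' ∪ S ⊆ lattice x L) (ω : Ω) :
    ω ∈ bevent M x L B B' S ↔
      (M.Y ω ∈ acceptable ϱ x L ∧ label x L (M.Y ω) = B ∪ B' ∪ S) ∧
      (∃ S' ⊆ S, M.X ω ∈ acceptable ϱ x L ∧ label x L (M.X ω) = B ∪ S') ∧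
      ∃ S' ⊆ S, M.X' ω ∈ acceptable ϱ x L ∧ label x L (M.X' ω) = B' ∪ S' := by
  have hB : B ⊆ lattice x L := fun z hz => h (Or.inl (Or.inl hz))
  have hB' : B' ⊆ lattice x L := fun z hz => h (Or.inl (Or.inr hz))
  have hS : S ⊆ lattice x L := fun z hz => h (Or.inr hz)
  have hconf : ∀ (Z A : Set (E d)), A ⊆ lattice x L → (Z ∈ bconfset ϱ x L A S ↔
      ∃ S' ⊆ S, Z ∈ acceptable ϱ x L ∧ label x L Z = A ∪ S') := by
    intro Z A hA
    simp only [bconfset, mem_iUnion, exists_prop, mem_powerset_iff]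
    refine exists_congr fun S' => and_congr_right fun hS' => ?_
    exact mem_eqClass_iff (union_subset hA (hS'.trans hS))
  exact and_congr (mem_eqClass_iff h) (and_congr (hconf _ _ hB) (hconf _ _ hB'))

/-- Basic events whose free sites are exactly the labels in a fixed region `F` are determined by the
configuration. -/
theorem eq_of_mem_bevent (M : MarkedPoissonProcess d ϱ P) {x : E d} {L : ℝ} {F : Set (E d)}
    {B B' S C C' T : Set (E d)} (hB : IsLabel ϱ x L B B' S) (hC : IsLabel ϱ x L C C' T)
    (hS : S = (B ∪ B' ∪ S) ∩ F) (hT : T = (C ∪ C' ∪ T) ∩ F) {ω : Ω}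
    (h : ω ∈ bevent M x L B B' S) (h' : ω ∈ bevent M x L C C' T) : B = C ∧ B' = C' ∧ S = T := by
  obtain ⟨⟨-, a1⟩, ⟨S₁, hS₁, -, a2⟩, S₂, hS₂, -, a3⟩ := (mem_bevent_iff M hB.2.2.2.1 ω).1 h
  obtain ⟨⟨-, b1⟩, ⟨T₁, hT₁, -, b2⟩, T₂, hT₂, -, b3⟩ := (mem_bevent_iff M hC.2.2.2.1 ω).1 h'
  have hdiff : ∀ {A A₁ U D : Set (E d)}, Disjoint A U → A₁ ⊆ U → A ⊆ D → U = D ∩ F →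
      (A ∪ A₁) \ F = A := by
    intro A A₁ U D h1 h2 h3 h4
    ext z
    constructor
    · rintro ⟨hz | hz, hzF⟩
      · exact hz
      · have := h2 hz
        rw [h4] at this
        exact absurd this.2 hzF
    · intro hz
      refine ⟨Or.inl hz, fun hzF => disjoint_left.1 h1 hz ?_⟩
      rw [h4]
      exact ⟨h3 hz, hzF⟩
  have e1 := hdiff hB.2.1 hS₁ (fun z hz => Or.inl (Or.inl hz)) hS
  have e2 := hdiff hC.2.1 hT₁ (fun z hz => Or.inl (Or.inl hz)) hT
  have e3 := hdiff hB.2.2.1 hS₂ (fun z hz => Or.inl (Or.inr hz)) hS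
  have e4 := hdiff hC.2.2.1 hT₂ (fun z hz => Or.inl (Or.inr hz)) hT
  refine ⟨?_, ?_, ?_⟩
  · rw [← e1, ← e2, ← a2, ← b2]
  · rw [← e3, ← e4, ← a3, ← b3]
  · rw [hS, hT, ← a1, ← b1]

/-- The adapted basic events whose free sites are the labels in a fixed region `F` make up a
localized event. -/
theorem exists_isLocalizedEvent (M : MarkedPoissonProcess d ϱ P) (u : SingleSite d)
    (α β γ : ℝ) (x : E d) (L Eₙ m : ℝ) (F : Set (E d)) :
    ∃ A : Set Ω, IsLocalizedEvent M u α β γ x L Eₙ m A ∧ ∀ B B' S : Set (E d),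
      IsAdapted ϱ u α β γ x L Eₙ m B B' S → S = (B ∪ B' ∪ S) ∩ F → bevent M x L B B' S ⊆ A := by
  set I : Set (Set (E d) × Set (E d) × Set (E d)) :=
    {q | IsAdapted ϱ u α β γ x L Eₙ m q.1 q.2.1 q.2.2 ∧ q.2.2 = (q.1 ∪ q.2.1 ∪ q.2.2) ∩ F} with hI
  have hfin : I.Finite := by
    have hp := (lattice_finite x L).powerset
    refine (hp.prod (hp.prod hp)).subset fun q hq => ?_
    have h : q.1 ∪ q.2.1 ∪ q.2.2 ⊆ lattice x L := hq.1.1.2.2.2.1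
    exact ⟨fun z hz => h (Or.inl (Or.inl hz)), fun z hz => h (Or.inl (Or.inr hz)),
      fun z hz => h (Or.inr hz)⟩
  have := hfin.to_subtype
  let e := Finite.equivFin I
  refine ⟨⋃ i, bevent M x L (e.symm i).1.1 (e.symm i).1.2.1 (e.symm i).1.2.2,
    ⟨Nat.card I, fun i => (e.symm i).1.1, fun i => (e.symm i).1.2.1, fun i => (e.symm i).1.2.2,
      fun i => (e.symm i).2.1, fun i j hij => ?_, rfl⟩, fun B B' S hB hS ω hω => ?_⟩
  · refine disjoint_left.2 fun ω hω hω' => hij ?_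
    have h := eq_of_mem_bevent M (e.symm i).2.1.1 (e.symm j).2.1.1 (e.symm i).2.2 (e.symm j).2.2
      hω hω'
    apply e.symm.injective
    exact Subtype.ext (Prod.ext h.1 (Prod.ext h.2.1 h.2.2))
  · refine mem_iUnion.2 ⟨e ⟨(B, B', S), hB, hS⟩, ?_⟩
    rw [e.symm_apply_apply]
    exact hω

/-- The basic event of a configuration: sites in the odd region are free, the others keep their
marks. -/
theorem mem_bevent_labels (M : MarkedPoissonProcess d ϱ P) {x : E d} {L : ℝ} (F : Set (E d))
    {ω : Ω} (hacc : M.Y ω ∈ acceptable ϱ x L) :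
    IsLabel ϱ x L (label x L (M.X ω) \ F) (label x L (M.X' ω) \ F) (label x L (M.Y ω) ∩ F) ∧
    label x L (M.Y ω) ∩ F = (label x L (M.X ω) \ F ∪ label x L (M.X' ω) \ F ∪
      label x L (M.Y ω) ∩ F) ∩ F ∧
    ω ∈ bevent M x L (label x L (M.X ω) \ F) (label x L (M.X' ω) \ F) (label x L (M.Y ω) ∩ F) := by
  have hY : M.X ω ∪ M.X' ω = M.Y ω := by
    ext ζ
    constructor
    · rintro (h | h) <;> exact h.1
    · intro h
      rcases hm : M.mark ω ζ with _ | _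
      · exact Or.inr ⟨h, hm⟩
      · exact Or.inl ⟨h, hm⟩
  have hXX : Disjoint (M.X ω) (M.X' ω) :=
    disjoint_left.2 fun ζ h h' => by simpa using h.2.symm.trans h'.2
  have hlabel : label x L (M.Y ω) = label x L (M.X ω) ∪ label x L (M.X' ω) := by
    rw [← label_union, hY]
  have hunion : label x L (M.X ω) \ F ∪ label x L (M.X' ω) \ F ∪ label x L (M.Y ω) ∩ F =
      label x L (M.Y ω) := by
    rw [← union_sdiff_distrib, ← hlabel, sdiff_union_inter]
  have hdis := disjoint_label (by rwa [hY]) hXX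
  refine ⟨⟨hdis.mono sdiff_subset sdiff_subset,
    disjoint_left.2 fun z h h' => h.2 h'.2,
    disjoint_left.2 fun z h h' => h.2 h'.2, ?_⟩, ?_, ?_⟩
  · rw [hunion]
    exact label_mem_latticeConfigs hacc
  · rw [hunion]
  · rw [mem_bevent_iff M (by rw [hunion]; exact label_subset_lattice x L _), hunion]
    refine ⟨⟨hacc, rfl⟩, ⟨label x L (M.X ω) ∩ F, ?_, ?_, (sdiff_union_inter _ _).symm⟩,
      label x L (M.X' ω) ∩ F, ?_, ?_, (sdiff_union_inter _ _).symm⟩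
    · exact inter_subset_inter_left _ (label_mono x L (M.X_subset_Y ω))
    · exact acceptable_of_subset (M.X_subset_Y ω) hacc
    · exact inter_subset_inter_left _ (label_mono x L (M.X'_subset_Y ω))
    · exact acceptable_of_subset (M.X'_subset_Y ω) hacc

end Event

end PoissonHam

namespace PoissonHam

variable {d : ℕ} {ϱ : ℝ} {Ω : Type*} [MeasurableSpace Ω] {P : Measure Ω}

/-! ### The probability of the localized event -/

theorem toReal_volume_box (x : E d) {s : ℝ} (hs : 0 ≤ s) : (volume (box x s)).toReal = s ^ d := by
  rw [volume_box, ENNReal.toReal_pow, ENNReal.toReal_ofReal hs]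

theorem volume_box_ne_top (x : E d) (s : ℝ) : volume (box x s) ≠ ∞ := by
  rw [volume_box]
  exact ENNReal.pow_ne_top ENNReal.ofReal_ne_top

theorem measurableSet_exceptional (x : E d) (L : ℝ) :
    MeasurableSet (box x L \ ⋃ j ∈ lattice x L, box j (eta d L * (1 - eta d L))) :=
  (measurableSet_box x L).diff
    ((lattice_finite x L).measurableSet_biUnion fun _ _ => measurableSet_box _ _)

/-- The boundary layers of the cells of side `η_L` have small total volume. -/
theorem volume_exceptional_le (x : E d) {L : ℝ} (hL : 1 ≤ L) (hη : 2 * eta d L ≤ 1) :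
    (volume (box x L \ ⋃ j ∈ lattice x L, box j (eta d L * (1 - eta d L)))).toReal ≤
      3 * d * eta d L * L ^ d := by
  set η := eta d L with hηdef
  have hη0 : 0 < η := eta_pos d L
  have hg := grid_finite x L hη0
  have hU : ⋃ j ∈ lattice x L, box j (η * (1 - η)) =
      ⋃ n ∈ hg.toFinset, box (cell x η n) (η * (1 - η)) := by
    rw [lattice_eq_image, biUnion_image]
    simp only [Finite.mem_toFinset]
    rfl
  have hsub : ⋃ n ∈ hg.toFinset, box (cell x η n) (η * (1 - η)) ⊆ box x L := by
    refine iUnion₂_subset fun n hn => (box_mono _ (by nlinarith)).trans (hg.mem_toFinset.1 hn)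
  have hmeas : MeasurableSet (⋃ n ∈ hg.toFinset, box (cell x η n) (η * (1 - η))) :=
    Finset.measurableSet_biUnion _ fun _ _ => measurableSet_box _ _
  have hvol : (volume (⋃ n ∈ hg.toFinset, box (cell x η n) (η * (1 - η)))).toReal =
      hg.toFinset.card * (η * (1 - η)) ^ d := by
    rw [measure_biUnion_finset _ fun _ _ => measurableSet_box _ _]
    · simp only [volume_box, Finset.sum_const, nsmul_eq_mul, ENNReal.toReal_mul,
        ENNReal.toReal_natCast, ENNReal.toReal_pow]
      rw [ENNReal.toReal_ofReal (by nlinarith)]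
    · intro n _ n' _ hnn
      refine disjoint_left.2 fun z hz hz' => hnn ?_
      exact eq_of_mem_box_cell hη0 (box_mono _ (by nlinarith) hz) (box_mono _ (by nlinarith) hz')
  rw [hU, ← measureReal_def, measureReal_sdiff hsub hmeas (volume_box_ne_top x L), measureReal_def,
    measureReal_def, hvol, toReal_volume_box x (by linarith)]
  have h1 := le_card_grid x hη0 (by linarith : 2 * η ≤ L)
  have h2 : (L / η - 2) ^ d * (η * (1 - η)) ^ d ≤ hg.toFinset.card * (η * (1 - η)) ^ d := by
    have : 0 ≤ η * (1 - η) := by nlinarith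
    gcongr
  have h3 : (L / η - 2) ^ d * (η * (1 - η)) ^ d = L ^ d * ((1 - 2 * η / L) * (1 - η)) ^ d := by
    rw [← mul_pow, ← mul_pow]
    congr 1
    field_simp
  have h4 : 1 - 3 * η ≤ (1 - 2 * η / L) * (1 - η) := by
    have h5 : 2 * η / L ≤ 2 * η := div_le_self (by positivity) hL
    have h6 : 0 ≤ 2 * η / L * η := by positivity
    nlinarith
  have h7 : 1 - 3 * d * η ≤ ((1 - 2 * η / L) * (1 - η)) ^ d := by
    have h8 := one_add_mul_le_pow (a := (1 - 2 * η / L) * (1 - η) - 1) (by linarith) d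
    rw [add_sub_cancel] at h8
    refine le_trans ?_ h8
    have h9 : (d : ℝ) * (-3 * η) ≤ d * ((1 - 2 * η / L) * (1 - η) - 1) := by
      gcongr
      linarith
    linarith
  have h10 : L ^ d * (1 - 3 * d * η) ≤ L ^ d * ((1 - 2 * η / L) * (1 - η)) ^ d := by gcongr
  linarith

/-- The configurations that are acceptable and occupy the cells have high probability. -/
theorem prob_bad_le [IsProbabilityMeasure P] (M : MarkedPoissonProcess d ϱ P) (hϱ : 0 ≤ ϱ)
    (x : E d) {l L : ℝ} (hl : 1 ≤ l) (hL : 1 ≤ L) (hη : 2 * eta d L ≤ 1) :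
    P {ω | ¬ (M.Y ω ∈ acceptable ϱ x L ∧ OccupiesCells x l L (M.X ω))} ≤
      ENNReal.ofReal (Real.exp (-(12 * ϱ * L ^ d)) +
        (L / eta d L + 1) ^ d * (2 * ϱ * eta d L ^ d) ^ 2 +
        2 * ϱ * (3 * d * eta d L * L ^ d) +
        (L / l + 1) ^ d * Real.exp (-(ϱ * (l - 1) ^ d))) := by
  have hη0 : 0 < eta d L := eta_pos d L
  have hl0 : 0 < l := by linarith
  have hg := grid_finite x L hη0
  have hgl := grid_finite x L hl0
  set ex := box x L \ ⋃ j ∈ lattice x L, box j (eta d L * (1 - eta d L)) with hex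
  have hexfin : volume ex ≠ ∞ := measure_ne_top_of_subset sdiff_subset (volume_box_ne_top x L)
  have hsub : {ω | ¬ (M.Y ω ∈ acceptable ϱ x L ∧ OccupiesCells x l L (M.X ω))} ⊆
      {ω | ENNReal.ofReal (16 * ϱ * L ^ d) ≤ (count (M.Y ω) (box x L) : ℝ≥0∞)} ∪
      (⋃ n ∈ hg.toFinset, {ω | ¬ count (M.Y ω) (box (cell x (eta d L) n) (eta d L)) ≤ 1}) ∪
      {ω | count (M.Y ω) ex ≠ 0} ∪
      ⋃ n ∈ hgl.toFinset, {ω | count (M.X ω) (box (cell x l n) (l - 1)) = 0} := by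
    intro ω hω
    by_contra h
    simp only [mem_union, not_or, mem_iUnion, exists_prop, not_exists, not_and, mem_ofPred_eq,
      not_not, Finite.mem_toFinset, not_le] at h
    obtain ⟨⟨⟨h1, h2⟩, h3⟩, h4⟩ := h
    refine hω ⟨⟨M.countable_Y ω, h1, fun j hj => ?_, h3⟩, h4⟩
    rw [lattice_eq_image] at hj
    obtain ⟨n, hn, rfl⟩ := hj
    exact not_lt.1 (h2 n hn)
  have p1 : P {ω | ENNReal.ofReal (16 * ϱ * L ^ d) ≤ (count (M.Y ω) (box x L) : ℝ≥0∞)} ≤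
      ENNReal.ofReal (Real.exp (-(12 * ϱ * L ^ d))) := by
    have h := (M.isPoissonCount_Y hϱ (measurableSet_box x L) (volume_box_ne_top x L)).prob_ge_le
    rw [toReal_volume_box x (by linarith)] at h
    convert h using 3 <;> ring_nf
  have p2 : P (⋃ n ∈ hg.toFinset,
      {ω | ¬ count (M.Y ω) (box (cell x (eta d L) n) (eta d L)) ≤ 1}) ≤
      ENNReal.ofReal ((L / eta d L + 1) ^ d * (2 * ϱ * eta d L ^ d) ^ 2) := by
    calc _ ≤ ∑ n ∈ hg.toFinset, ENNReal.ofReal ((2 * ϱ * eta d L ^ d) ^ 2) := by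
          refine (measure_biUnion_finset_le _ _).trans (Finset.sum_le_sum fun n _ => ?_)
          have h := (M.isPoissonCount_Y hϱ (measurableSet_box (cell x (eta d L) n) (eta d L))
            (volume_box_ne_top _ _)).prob_not_le_one_le
          rwa [toReal_volume_box _ hη0.le] at h
      _ = ENNReal.ofReal (hg.toFinset.card * (2 * ϱ * eta d L ^ d) ^ 2) := by
          rw [Finset.sum_const, nsmul_eq_mul, ENNReal.ofReal_mul (by positivity),
            ENNReal.ofReal_natCast]
      _ ≤ _ := by
          refine ENNReal.ofReal_le_ofReal ?_
          gcongr
          exact card_grid_le x hη0 (by linarith)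
  have p3 : P {ω | count (M.Y ω) ex ≠ 0} ≤ ENNReal.ofReal (2 * ϱ * (3 * d * eta d L * L ^ d)) := by
    refine (M.isPoissonCount_Y hϱ (measurableSet_exceptional x L) hexfin).prob_ne_zero_le.trans ?_
    refine ENNReal.ofReal_le_ofReal ?_
    gcongr
    exact volume_exceptional_le x hL hη
  have p4 : P (⋃ n ∈ hgl.toFinset, {ω | count (M.X ω) (box (cell x l n) (l - 1)) = 0}) ≤
      ENNReal.ofReal ((L / l + 1) ^ d * Real.exp (-(ϱ * (l - 1) ^ d))) := by
    calc _ ≤ ∑ n ∈ hgl.toFinset, ENNReal.ofReal (Real.exp (-(ϱ * (l - 1) ^ d))) := by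
          refine (measure_biUnion_finset_le _ _).trans (Finset.sum_le_sum fun n _ => ?_)
          have h := (M.isPoissonCount_X hϱ (measurableSet_box (cell x l n) (l - 1))
            (volume_box_ne_top _ _)).prob_eq_zero
          rw [toReal_volume_box _ (by linarith)] at h
          exact h.le
      _ = ENNReal.ofReal (hgl.toFinset.card * Real.exp (-(ϱ * (l - 1) ^ d))) := by
          rw [Finset.sum_const, nsmul_eq_mul, ENNReal.ofReal_mul (by positivity),
            ENNReal.ofReal_natCast]
      _ ≤ _ := by
          refine ENNReal.ofReal_le_ofReal ?_
          gcongr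
          exact card_grid_le x hl0 (by linarith)
  have hL0 : 0 ≤ L := by linarith
  rw [ENNReal.ofReal_add (by positivity) (by positivity),
    ENNReal.ofReal_add (by positivity) (by positivity),
    ENNReal.ofReal_add (by positivity) (by positivity)]
  refine (measure_mono hsub).trans ((measure_union_le _ _).trans (add_le_add ?_ p4))
  refine (measure_union_le _ _).trans (add_le_add ?_ p3)
  exact (measure_union_le _ _).trans (add_le_add p1 p2)

/-- Reduction of the localizing property to inequalities between scales: `l` is the side of the
cells, `E₀` the lower bound for the operator and `θ` the Combes–Thomas rate. -/
theorem isLocalizingScale_of_inequalities [IsProbabilityMeasure P] (hd : 0 < d)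
    (M : MarkedPoissonProcess d ϱ P) (u : SingleSite d) (hϱ : 0 ≤ ϱ) {α β γ p Eₙ m E₀ θ l L : ℝ}
    {N : ℕ} (hl : 1 ≤ l) (hL : 4 * l ≤ L) (hη : 2 * eta d L ≤ 1)
    (h0 : 0 < E₀) (hE₀ : E₀ * ((4 * (4 * l) / u.deltaMinus + 5) ^ d *
      (2 / u.uMinus + 2 * (d * (4 * l + u.deltaMinus) ^ 2))) ≤ 1)
    (hEn : 4 * Eₙ ≤ E₀) (hθ : 0 ≤ θ) (hθE : 4 * θ ^ 2 ≤ E₀)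
    (hnorm : 2 / E₀ ≤ Real.exp (L ^ (1 - α)))
    (hdecay : ∀ s, L / 10 ≤ s →
      2 / E₀ * Real.exp (θ * Real.sqrt d) * Real.exp (-θ * s) ≤ Real.exp (-m * s))
    (hN : l * (4 * N + 3) ≤ L ^ (1 - β) - u.deltaPlus)
    (hN' : L ^ ((d : ℝ) - γ) ≤ (2 * N + 1 : ℝ) ^ d)
    (hprob : Real.exp (-(12 * ϱ * L ^ d)) +
        (L / eta d L + 1) ^ d * (2 * ϱ * eta d L ^ d) ^ 2 +
        2 * ϱ * (3 * d * eta d L * L ^ d) +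
        (L / l + 1) ^ d * Real.exp (-(ϱ * (l - 1) ^ d)) < L ^ (-p)) :
    IsLocalizingScale M u α β γ p Eₙ m L := by
  intro x
  have hl0 : 0 < l := by linarith
  have hL0 : 0 < L := by linarith
  obtain ⟨A, hA, hsub⟩ := exists_isLocalizedEvent M u α β γ x L Eₙ m (oddRegion x l)
  refine ⟨A, hA, ?_⟩
  have hgood : {ω | ¬ (M.Y ω ∈ acceptable ϱ x L ∧ OccupiesCells x l L (M.X ω))}ᶜ ⊆ A := by
    intro ω hω
    obtain ⟨hacc, hocc⟩ : M.Y ω ∈ acceptable ϱ x L ∧ OccupiesCells x l L (M.X ω) := by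
      simpa using hω
    obtain ⟨h1, h2, h3⟩ := mem_bevent_labels M (oddRegion x l) hacc
    refine hsub _ _ _ ⟨h1, ?_, ?_⟩ h2 h3
    · have hB : label x L (M.X ω) \ oddRegion x l ⊆ lattice x L :=
        sdiff_subset.trans (label_subset_lattice x L _)
      have hS : label x L (M.Y ω) ∩ oddRegion x l ⊆ lattice x L :=
        inter_subset_left.trans (label_subset_lattice x L _)
      exact isGoodBox_of_relDense u h1.2.1 ((lattice_finite x L).subset hB)
        ((lattice_finite x L).subset hS) (hB.trans (lattice_subset_box x L))
        (hS.trans (lattice_subset_box x L)) (by positivity : 0 ≤ 4 * l)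
        (fun y hy => label_diff_relDense hd hl0 hL
          (acceptable_of_subset (M.X_subset_Y ω) hacc) hocc hy)
        h0 hE₀ hEn hθ hθE hnorm hdecay
    · intro y hy
      have h4 := le_count_label_inter hl0 hL0 (acceptable_of_subset (M.X_subset_Y ω) hacc) hocc
        ((box_mono y (by linarith [u.deltaPlus_pos])).trans hy) hN
      have h5 : (((2 * N + 1) ^ d : ℕ) : ℕ∞) ≤ count (label x L (M.Y ω) ∩ oddRegion x l)
          (box y (L ^ (1 - β) - u.deltaPlus)) :=
        h4.trans (count_mono (inter_subset_inter_left _ (label_mono x L (M.X_subset_Y ω)))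
          subset_rfl)
      refine le_trans ?_ (ENat.toENNReal_le.2 h5)
      rw [ENat.toENNReal_coe, ← ENNReal.ofReal_natCast]
      refine ENNReal.ofReal_le_ofReal (hN'.trans (le_of_eq ?_))
      push_cast
      rfl
  set bad := {ω | ¬ (M.Y ω ∈ acceptable ϱ x L ∧ OccupiesCells x l L (M.X ω))} with hbad
  have hbadlt : P.real bad < L ^ (-p) := by
    refine lt_of_le_of_lt ?_ hprob
    rw [measureReal_def]
    have hL1 : 0 ≤ L / eta d L := div_nonneg hL0.le (eta_pos d L).le
    have := (eta_pos d L).le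
    refine ENNReal.toReal_le_of_le_ofReal ?_ (prob_bad_le M hϱ x hl (by linarith) hη)
    positivity
  -- no measurability is needed: the outer measures of a set and its complement add up to at least 1
  have h1 : (1 : ℝ) ≤ P.real badᶜ + P.real bad := by
    have := measureReal_union_le (μ := P) badᶜ bad
    rwa [compl_union_self, probReal_univ] at this
  have h2 : P.real badᶜ ≤ P.real A := measureReal_mono hgood
  linarith

end PoissonHam

namespace PoissonHam

/-! ### Asymptotics of the scales -/

theorem one_le_deltaScale {d : ℕ} {ϱ p L : ℝ} (hϱ : 0 < ϱ) (hp : 0 < p) (hL : 1 ≤ L) :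
    1 ≤ deltaScale d ϱ p L := by
  have := Real.log_nonneg hL
  rw [deltaScale, le_add_iff_nonneg_right]
  positivity

theorem mul_deltaScale_sub_one_pow {d : ℕ} (hd : 0 < d) {ϱ p L : ℝ} (hϱ : 0 < ϱ) (hp : 0 < p)
    (hL : 1 ≤ L) : ϱ * (deltaScale d ϱ p L - 1) ^ d = (p + d + 1) * Real.log L := by
  have := Real.log_nonneg hL
  rw [deltaScale, add_sub_cancel_left, one_div, Real.rpow_inv_natCast_pow (by positivity) hd.ne']
  field_simp

theorem eventually_const_mul_log_le (c : ℝ) {a : ℝ} (ha : 0 < a) :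
    ∀ᶠ L : ℝ in atTop, c * Real.log L ≤ L ^ a := by
  have h := ((isLittleO_log_rpow_atTop ha).const_mul_left c).bound one_pos
  filter_upwards [h, eventually_ge_atTop 0] with L h1 h2
  rw [one_mul, Real.norm_of_nonneg (Real.rpow_nonneg h2 a)] at h1
  exact (Real.le_norm_self _).trans h1

/-- The side of the cells grows slower than every power of `L`. -/
theorem eventually_deltaScale_le {d : ℕ} (hd : 0 < d) {ϱ p : ℝ} (hϱ : 0 < ϱ) (hp : 0 < p) {a : ℝ}
    (ha : 0 < a) : ∀ᶠ L : ℝ in atTop, deltaScale d ϱ p L ≤ L ^ a := by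
  filter_upwards [eventually_const_mul_log_le (2 * ((p + d + 1) * ϱ⁻¹)) ha,
    (tendsto_rpow_atTop ha).eventually_ge_atTop 4, eventually_ge_atTop 1] with L h1 h2 h3
  have hlog := Real.log_nonneg h3
  have hx : 0 ≤ (p + d + 1) * ϱ⁻¹ * Real.log L := by positivity
  have h4 : ((p + d + 1) * ϱ⁻¹ * Real.log L) ^ (1 / (d : ℝ)) ≤
      1 + (p + d + 1) * ϱ⁻¹ * Real.log L := by
    have hd1 : 1 / (d : ℝ) ≤ 1 := by
      rw [div_le_one (by exact_mod_cast hd)]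
      exact_mod_cast hd
    calc _ ≤ (1 + (p + d + 1) * ϱ⁻¹ * Real.log L) ^ (1 / (d : ℝ)) :=
          Real.rpow_le_rpow hx (by linarith) (by positivity)
      _ ≤ (1 + (p + d + 1) * ϱ⁻¹ * Real.log L) ^ (1 : ℝ) :=
          Real.rpow_le_rpow_of_exponent_le (by linarith) hd1
      _ = _ := Real.rpow_one _
  rw [deltaScale]
  linarith

theorem energyScale_eq {d : ℕ} {C ϱ p L : ℝ} (h : 0 ≤ deltaScale d ϱ p L) :
    energyScale d C ϱ p L = C / (deltaScale d ϱ p L ^ (d + 1)) ^ 2 := by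
  rw [energyScale, Real.rpow_neg h, ← pow_mul, div_eq_mul_inv]
  congr 2
  rw [← Real.rpow_natCast]
  congr 1
  push_cast
  ring

theorem eta_le_exp_neg {d : ℕ} (hd : 0 < d) {L : ℝ} (hL : 1 ≤ L) : eta d L ≤ Real.exp (-L) := by
  rw [eta]
  refine Real.exp_le_exp.2 (neg_le_neg ?_)
  exact le_self_pow₀ hL (Nat.mul_pos (by positivity) hd).ne'

/-- The constant in the lower bound for the operator, with the scale factored out. -/
noncomputable def formConst {d : ℕ} (u : SingleSite d) : ℝ :=
  (16 / u.deltaMinus + 5) ^ d * (2 / u.uMinus + 2 * (d * (4 + u.deltaMinus) ^ 2))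

theorem formConst_pos {d : ℕ} (u : SingleSite d) : 0 < formConst u := by
  have h1 := u.uMinus_pos
  have h2 := u.deltaMinus_pos
  unfold formConst
  positivity

theorem formConst_mul_ge {d : ℕ} (u : SingleSite d) {l : ℝ} (hl : 1 ≤ l) :
    (4 * (4 * l) / u.deltaMinus + 5) ^ d * (2 / u.uMinus + 2 * (d * (4 * l + u.deltaMinus) ^ 2)) ≤
      formConst u * (l ^ (d + 1)) ^ 2 := by
  have h1 := u.uMinus_pos
  have h2 := u.deltaMinus_pos
  have e1 : 4 * (4 * l) / u.deltaMinus + 5 ≤ (16 / u.deltaMinus + 5) * l := by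
    have : 4 * (4 * l) / u.deltaMinus = 16 / u.deltaMinus * l := by ring
    rw [this]
    linarith
  have e2 : 4 * l + u.deltaMinus ≤ (4 + u.deltaMinus) * l := by nlinarith
  have e3 : 2 / u.uMinus ≤ 2 / u.uMinus * l ^ 2 :=
    le_mul_of_one_le_right (by positivity) (one_le_pow₀ hl)
  calc _ ≤ ((16 / u.deltaMinus + 5) * l) ^ d *
        (2 / u.uMinus * l ^ 2 + 2 * (d * ((4 + u.deltaMinus) * l) ^ 2)) := by gcongr
    _ = formConst u * l ^ (d + 2) := by
        rw [formConst, mul_pow, mul_pow, pow_add]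
        ring
    _ ≤ formConst u * l ^ ((d + 1) * 2) := by
        have := (formConst_pos u).le
        gcongr
        omega
    _ = _ := by rw [pow_mul]

/-- Many odd cells fit into a box of side `L^{1-β}`. -/
theorem eventually_exists_cells {d : ℕ} (hd : 0 < d) {ϱ p β γ δ : ℝ} (hϱ : 0 < ϱ) (hp : 0 < p)
    (hβ : β < 1) (hγ : (d : ℝ) * β < γ) (hδ : 0 ≤ δ) :
    ∀ᶠ L : ℝ in atTop, ∃ N : ℕ, deltaScale d ϱ p L * (4 * N + 3) ≤ L ^ (1 - β) - δ ∧
      L ^ ((d : ℝ) - γ) ≤ (2 * N + 1 : ℝ) ^ d := by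
  have hd0 : (0 : ℝ) < d := by exact_mod_cast hd
  set b := 1 - γ / d with hb
  set σ := max b 0 with hσ
  have hσβ : σ < 1 - β := by
    refine max_lt ?_ (by linarith)
    have : β < γ / d := by
      rw [lt_div_iff₀ hd0]
      linarith
    linarith
  set ε := (1 - β - σ) / 2 with hε
  have hε0 : 0 < ε := by linarith
  filter_upwards [eventually_deltaScale_le hd hϱ hp hε0,
    (tendsto_rpow_atTop hε0).eventually_ge_atTop (11 + δ), eventually_ge_atTop 1] with L h1 h2 h3
  have hL0 : 0 < L := by linarith
  have hσ0 : 0 ≤ σ := le_max_right _ _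
  have e1 : L ^ b ≤ L ^ σ := Real.rpow_le_rpow_of_exponent_le h3 (le_max_left _ _)
  have e2 : 1 ≤ L ^ σ := Real.one_le_rpow h3 hσ0
  have e3 : 0 ≤ L ^ b := Real.rpow_nonneg hL0.le _
  have e4 : 1 ≤ L ^ ε := Real.one_le_rpow h3 hε0.le
  refine ⟨⌈L ^ b⌉₊, ?_, ?_⟩
  · have h4 : (⌈L ^ b⌉₊ : ℝ) ≤ L ^ b + 1 := (Nat.ceil_lt_add_one e3).le
    have h5 : L ^ (1 - β) = L ^ ε * (L ^ ε * L ^ σ) := by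
      rw [← Real.rpow_add hL0, ← Real.rpow_add hL0]
      congr 1
      rw [hε]
      ring
    have h6 : deltaScale d ϱ p L * (4 * ⌈L ^ b⌉₊ + 3) ≤ L ^ ε * (11 * L ^ σ) := by
      gcongr
      linarith
    have h7 : 1 ≤ L ^ ε * L ^ σ := one_le_mul_of_one_le_of_one_le e4 e2
    have h8 : (11 + δ) * (L ^ ε * L ^ σ) ≤ L ^ ε * (L ^ ε * L ^ σ) := by gcongr
    have h9 : δ ≤ δ * (L ^ ε * L ^ σ) := le_mul_of_one_le_right hδ h7
    rw [h5]
    linarith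
  · have h4 : L ^ ((d : ℝ) - γ) = (L ^ b) ^ d := by
      rw [← Real.rpow_natCast, ← Real.rpow_mul hL0.le]
      congr 1
      rw [hb]
      field_simp
    rw [h4]
    have h5 := Nat.le_ceil (L ^ b)
    gcongr
    linarith

theorem eventually_const_mul_rpow_le_exp (c s : ℝ) {b : ℝ} (hb : 0 < b) :
    ∀ᶠ L : ℝ in atTop, c * L ^ s ≤ Real.exp (b * L) := by
  have h := ((isLittleO_rpow_exp_pos_mul_atTop s hb).const_mul_left c).bound one_pos
  filter_upwards [h] with L h1
  rw [one_mul, Real.norm_of_nonneg (Real.exp_pos _).le] at h1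
  exact (Real.le_norm_self _).trans h1

/-- The probability of the bad configurations is smaller than `L^{-p}`. -/
theorem eventually_prob_lt {d : ℕ} (hd : 0 < d) {ϱ p : ℝ} (hϱ : 0 < ϱ) (hp : 0 < p) :
    ∀ᶠ L : ℝ in atTop, Real.exp (-(12 * ϱ * L ^ d)) +
        (L / eta d L + 1) ^ d * (2 * ϱ * eta d L ^ d) ^ 2 +
        2 * ϱ * (3 * d * eta d L * L ^ d) +
        (L / deltaScale d ϱ p L + 1) ^ d * Real.exp (-(ϱ * (deltaScale d ϱ p L - 1) ^ d)) <
      L ^ (-p) := by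
  set c := 4 * ϱ ^ 2 * 2 ^ d + 6 * ϱ * d with hc
  filter_upwards [eventually_ge_atTop 1, eventually_ge_atTop (8 * 2 ^ d),
    eventually_const_mul_rpow_le_exp 8 p (b := 12 * ϱ) (by positivity),
    eventually_const_mul_rpow_le_exp (8 * c) (d + p) one_pos] with L h1 h2 h3 h4
  have hL0 : 0 < L := by linarith
  have hη0 := eta_pos d L
  have hη1 := eta_lt_one d hL0
  have hη := eta_le_exp_neg hd h1
  have hδ := one_le_deltaScale (d := d) hϱ hp h1
  have hr : 0 < L ^ (-p) := Real.rpow_pos_of_pos hL0 _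
  have hpp : L ^ p * L ^ (-p) = 1 := by rw [← Real.rpow_add hL0, add_neg_cancel, Real.rpow_zero]
  have t1 : Real.exp (-(12 * ϱ * L ^ d)) ≤ L ^ (-p) / 8 := by
    have e1 : Real.exp (-(12 * ϱ * L ^ d)) ≤ Real.exp (-(12 * ϱ * L)) := by
      have : L ≤ L ^ d := le_self_pow₀ h1 hd.ne'
      gcongr
    have e2 : Real.exp (-(12 * ϱ * L)) * Real.exp (12 * ϱ * L) = 1 := by
      rw [← Real.exp_add, neg_add_cancel, Real.exp_zero]
    have e3 : Real.exp (-(12 * ϱ * L)) * (8 * L ^ p) ≤ 1 := by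
      rw [← e2]
      gcongr
    calc _ ≤ Real.exp (-(12 * ϱ * L)) := e1
      _ = Real.exp (-(12 * ϱ * L)) * (8 * L ^ p) * (L ^ (-p) / 8) := by
          rw [show Real.exp (-(12 * ϱ * L)) * (8 * L ^ p) * (L ^ (-p) / 8) =
            Real.exp (-(12 * ϱ * L)) * (L ^ p * L ^ (-p)) by ring, hpp, mul_one]
      _ ≤ 1 * (L ^ (-p) / 8) := by gcongr
      _ = _ := one_mul _
  have t2 : (L / eta d L + 1) ^ d * (2 * ϱ * eta d L ^ d) ^ 2 ≤
      4 * ϱ ^ 2 * 2 ^ d * (L ^ d * Real.exp (-L)) := by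
    have e1 : (L / eta d L + 1) ^ d * (2 * ϱ * eta d L ^ d) ^ 2 =
        4 * ϱ ^ 2 * ((L + eta d L) ^ d * eta d L ^ d) := by
      have : L / eta d L + 1 = (L + eta d L) / eta d L := by field_simp
      rw [this, div_pow]
      field_simp
      ring
    have e2 : (L + eta d L) ^ d ≤ (2 * L) ^ d := by
      gcongr
      linarith
    have e3 : eta d L ^ d ≤ Real.exp (-L) := (pow_le_of_le_one hη0.le hη1.le hd.ne').trans hη
    rw [e1]
    calc 4 * ϱ ^ 2 * ((L + eta d L) ^ d * eta d L ^ d)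
        ≤ 4 * ϱ ^ 2 * ((2 * L) ^ d * Real.exp (-L)) := by gcongr
      _ = _ := by rw [mul_pow]; ring
  have t3 : 2 * ϱ * (3 * d * eta d L * L ^ d) ≤ 6 * ϱ * d * (L ^ d * Real.exp (-L)) := by
    calc _ ≤ 2 * ϱ * (3 * d * Real.exp (-L) * L ^ d) := by gcongr
      _ = _ := by ring
  have t23 : c * (L ^ d * Real.exp (-L)) ≤ L ^ (-p) / 8 := by
    have e1 : L ^ ((d : ℝ) + p) = L ^ d * L ^ p := by
      rw [Real.rpow_add hL0, Real.rpow_natCast]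
    rw [e1, one_mul] at h4
    have e2 : Real.exp (-L) * Real.exp L = 1 := by
      rw [← Real.exp_add, neg_add_cancel, Real.exp_zero]
    calc c * (L ^ d * Real.exp (-L)) =
          (8 * c * (L ^ d * L ^ p)) * Real.exp (-L) * (L ^ (-p) / 8) := by
          rw [show (8 * c * (L ^ d * L ^ p)) * Real.exp (-L) * (L ^ (-p) / 8) =
            c * (L ^ d * Real.exp (-L)) * (L ^ p * L ^ (-p)) by ring, hpp, mul_one]
      _ ≤ Real.exp L * Real.exp (-L) * (L ^ (-p) / 8) := by gcongr
      _ = _ := by rw [mul_comm (Real.exp L), e2, one_mul]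
  have t4 : (L / deltaScale d ϱ p L + 1) ^ d *
      Real.exp (-(ϱ * (deltaScale d ϱ p L - 1) ^ d)) ≤ L ^ (-p) / 8 := by
    have e1 : Real.exp (-(ϱ * (deltaScale d ϱ p L - 1) ^ d)) =
        L ^ (-p) * (L ^ d)⁻¹ * L⁻¹ := by
      rw [mul_deltaScale_sub_one_pow hd hϱ hp h1, ← Real.rpow_natCast L d, ← Real.rpow_neg hL0.le,
        ← Real.rpow_neg_one L, ← Real.rpow_add hL0, ← Real.rpow_add hL0, Real.rpow_def_of_pos hL0]
      congr 1
      ring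
    have e2 : L / deltaScale d ϱ p L + 1 ≤ 2 * L := by
      have := div_le_self hL0.le hδ
      linarith
    have e3 : 2 ^ d * L⁻¹ ≤ 1 / 8 := by
      rw [← div_eq_mul_inv, div_le_iff₀ hL0]
      linarith
    rw [e1]
    calc _ ≤ (2 * L) ^ d * (L ^ (-p) * (L ^ d)⁻¹ * L⁻¹) := by gcongr
      _ = L ^ (-p) * (2 ^ d * L⁻¹) := by
          rw [mul_pow]
          field_simp
      _ ≤ L ^ (-p) * (1 / 8) := by gcongr
      _ = _ := by ring
  have t5 : c * (L ^ d * Real.exp (-L)) = 4 * ϱ ^ 2 * 2 ^ d * (L ^ d * Real.exp (-L)) +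
      6 * ϱ * d * (L ^ d * Real.exp (-L)) := by rw [hc]; ring
  linarith

/-- For large `L` the resolvent bounds hold with room to spare: the spectral gap is at least a
constant times `L⁻¹` and the decay rate at least a constant times `L^{-1/2}`. -/
theorem eventually_resolvent_bounds {d : ℕ} (hd : 0 < d) {C ϱ p α : ℝ} (hC : 0 < C) (hϱ : 0 < ϱ)
    (hp : 0 < p) (hα : α < 1) :
    ∀ᶠ L : ℝ in atTop, 2 / (4 * energyScale d C ϱ p L) ≤ Real.exp (L ^ (1 - α)) ∧
      ∀ s, L / 10 ≤ s → 2 / (4 * energyScale d C ϱ p L) *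
        Real.exp (Real.sqrt (energyScale d C ϱ p L) * Real.sqrt d) *
        Real.exp (-Real.sqrt (energyScale d C ϱ p L) * s) ≤
          Real.exp (-rateScale d C ϱ p L * s) := by
  have hd1 : 0 < 1 / (2 * ((d : ℝ) + 1)) := by positivity
  set A := 1 / (2 * C) * Real.exp (Real.sqrt C * Real.sqrt d) with hA
  filter_upwards [eventually_ge_atTop 1, eventually_deltaScale_le hd hϱ hp hd1,
    eventually_ge_atTop (1 / (2 * C)), eventually_ge_atTop A,
    eventually_const_mul_log_le 2 (show 0 < 1 - α by linarith),
    eventually_const_mul_log_le (2 * (20 / Real.sqrt C)) (show (0 : ℝ) < 1 / 2 by norm_num)]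
    with L h1 h2 h3 h4 h5 h6
  have hL0 : 0 < L := by linarith
  have hδ := one_le_deltaScale (d := d) hϱ hp h1
  have hδ0 : 0 < deltaScale d ϱ p L := by linarith
  have hsC : 0 < Real.sqrt C := Real.sqrt_pos.2 hC
  set D := deltaScale d ϱ p L ^ (d + 1) with hD
  have hD1 : 1 ≤ D := one_le_pow₀ hδ
  have hDL : D ≤ L ^ (1 / 2 : ℝ) := by
    calc D ≤ (L ^ (1 / (2 * ((d : ℝ) + 1)))) ^ (d + 1) := by rw [hD]; gcongr
      _ = L ^ (1 / 2 : ℝ) := by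
          rw [← Real.rpow_natCast, ← Real.rpow_mul hL0.le]
          congr 1
          push_cast
          field_simp
  have hsq : L ^ (1 / 2 : ℝ) * L ^ (1 / 2 : ℝ) = L := by
    rw [← Real.rpow_add hL0]
    norm_num
  have hD2 : D ^ 2 ≤ L := by
    calc D ^ 2 ≤ (L ^ (1 / 2 : ℝ)) ^ 2 := by gcongr
      _ = L := by rw [sq, hsq]
  have hE : energyScale d C ϱ p L = C / D ^ 2 := energyScale_eq hδ0.le
  have hsE : Real.sqrt (energyScale d C ϱ p L) = Real.sqrt C / D := by
    rw [hE, Real.sqrt_div hC.le, Real.sqrt_sq (by positivity)]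
  have hgap : 2 / (4 * energyScale d C ϱ p L) ≤ 1 / (2 * C) * L := by
    rw [hE]
    calc 2 / (4 * (C / D ^ 2)) = 1 / (2 * C) * D ^ 2 := by field_simp; ring
      _ ≤ _ := by gcongr
  have hLL : ∀ {y : ℝ}, 2 * Real.log L ≤ y → L * L ≤ Real.exp y := fun {y} hy => by
    calc L * L = Real.exp (2 * Real.log L) := by
          rw [two_mul, Real.exp_add, Real.exp_log hL0]
      _ ≤ _ := Real.exp_le_exp.2 hy
  refine ⟨hgap.trans ((mul_le_mul_of_nonneg_right h3 hL0.le).trans (hLL h5)), fun s hs => ?_⟩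
  rw [rateScale, hsE]
  set θ := Real.sqrt C / D with hθ
  have hθ0 : 0 < θ := by positivity
  have hθC : θ ≤ Real.sqrt C := div_le_self hsC.le hD1
  have hpre : 2 / (4 * energyScale d C ϱ p L) * Real.exp (θ * Real.sqrt d) ≤ L * L := by
    calc _ ≤ 1 / (2 * C) * L * Real.exp (Real.sqrt C * Real.sqrt d) := by gcongr
      _ = A * L := by rw [hA]; ring
      _ ≤ L * L := by gcongr
  have hexp : 2 * Real.log L ≤ θ * s / 2 := by
    have e1 : Real.sqrt C / L ^ (1 / 2 : ℝ) ≤ θ := by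
      rw [hθ]
      gcongr
    have e2 : Real.sqrt C / 20 * L ^ (1 / 2 : ℝ) ≤ θ * s / 2 := by
      calc Real.sqrt C / 20 * L ^ (1 / 2 : ℝ)
          = Real.sqrt C / L ^ (1 / 2 : ℝ) * (L / 10) / 2 := by
            have : L ^ (1 / 2 : ℝ) ≠ 0 := (Real.rpow_pos_of_pos hL0 _).ne'
            field_simp
            rw [sq, hsq]
            ring
        _ ≤ θ * s / 2 := by gcongr
    refine le_trans ?_ e2
    have e3 := mul_le_mul_of_nonneg_left h6 (show 0 ≤ Real.sqrt C / 20 by positivity)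
    refine le_trans (le_of_eq ?_) e3
    field_simp
  calc _ ≤ Real.exp (θ * s / 2) * Real.exp (-θ * s) := by
        gcongr
        exact hpre.trans (hLL hexp)
    _ = _ := by
        rw [← Real.exp_add]
        congr 1
        ring

end PoissonHam

theorem proposition4p1 {d : ℕ} (hd : 0 < d) (u : PoissonHam.SingleSite d) :
    ∃ C : ℝ, 0 < C ∧
      ∀ ϱ p : ℝ, 0 < ϱ → 0 < p →
      ∀ α β γ κ : ℝ, 0 < α → α < 1 → 0 < β → β < 1 → (d : ℝ) * β < γ → 0 < κ →
      ∃ L₀ : ℝ, 0 < L₀ ∧ ∀ L : ℝ, L₀ ≤ L →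
        (L ^ (-κ) ≤ ϱ ∧ ϱ ≤ Real.exp (L ^ d)) ∧
        ∀ (Ω : Type*) [MeasurableSpace Ω] (P : Measure Ω) [IsProbabilityMeasure P]
          (M : PoissonHam.MarkedPoissonProcess d ϱ P),
          ∀ Eₙ ∈ Set.Icc 0 (PoissonHam.energyScale d C ϱ p L),
            PoissonHam.IsLocalizingScale M u α β γ p Eₙ
              (PoissonHam.rateScale d C ϱ p L) L := by
  have hK := PoissonHam.formConst_pos u
  refine ⟨1 / (4 * PoissonHam.formConst u), by positivity, ?_⟩
  intro ϱ p hϱ hp α β γ κ _ hα1 _ hβ1 hγ hκ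
  set C := 1 / (4 * PoissonHam.formConst u) with hC
  have hC0 : 0 < C := by positivity
  obtain ⟨L₁, hL₁⟩ := eventually_atTop.1
    (((((eventually_ge_atTop (1 : ℝ)).and (eventually_ge_atTop 16)).and
      ((eventually_ge_atTop ϱ).and ((tendsto_rpow_neg_atTop hκ).eventually_le_const hϱ))).and
      ((PoissonHam.eventually_deltaScale_le hd hϱ hp one_half_pos).and
        (PoissonHam.eventually_exists_cells hd hϱ hp hβ1 hγ u.deltaPlus_pos.le))).and
      ((PoissonHam.eventually_prob_lt hd hϱ hp).and
        (PoissonHam.eventually_resolvent_bounds hd hC0 hϱ hp hα1)))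
  refine ⟨max L₁ 1, by positivity, fun L hL => ?_⟩
  obtain ⟨⟨⟨⟨h1, h16⟩, hρL, hκL⟩, hδL, N, hN, hN'⟩, hprob, hnorm, hdecay⟩ :=
    hL₁ L ((le_max_left _ _).trans hL)
  have hL0 : 0 < L := by linarith
  have hLd : L ≤ L ^ d := le_self_pow₀ h1 hd.ne'
  refine ⟨⟨hκL, ?_⟩, fun Ω _ P _ M Eₙ hEₙ => ?_⟩
  · linarith [Real.add_one_le_exp (L ^ d)]
  have hδ := PoissonHam.one_le_deltaScale (d := d) hϱ hp h1
  have hδ0 : 0 < PoissonHam.deltaScale d ϱ p L := by linarith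
  have hE := PoissonHam.energyScale_eq (C := C) hδ0.le
  have hE0 : 0 < PoissonHam.energyScale d C ϱ p L := by rw [hE]; positivity
  have h4 : 4 * PoissonHam.deltaScale d ϱ p L ≤ L := by
    have e1 : L ^ (1 / 2 : ℝ) * L ^ (1 / 2 : ℝ) = L := by
      rw [← Real.rpow_add hL0]
      norm_num
    have e2 : 4 ≤ L ^ (1 / 2 : ℝ) := by
      by_contra h
      have : 0 ≤ L ^ (1 / 2 : ℝ) := Real.rpow_nonneg hL0.le _
      nlinarith
    calc _ ≤ L ^ (1 / 2 : ℝ) * L ^ (1 / 2 : ℝ) := by gcongr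
      _ = L := e1
  have hη : 2 * PoissonHam.eta d L ≤ 1 := by
    have e1 := PoissonHam.eta_le_exp_neg hd h1
    have e2 : Real.exp (-L) * Real.exp L = 1 := by
      rw [← Real.exp_add, neg_add_cancel, Real.exp_zero]
    nlinarith [Real.add_one_le_exp L, Real.exp_pos (-L)]
  refine PoissonHam.isLocalizingScale_of_inequalities hd M u hϱ.le hδ h4 hη
    (E₀ := 4 * PoissonHam.energyScale d C ϱ p L)
    (θ := Real.sqrt (PoissonHam.energyScale d C ϱ p L)) (by positivity) ?_
    (by linarith [hEₙ.2]) (Real.sqrt_nonneg _) (by rw [Real.sq_sqrt hE0.le]) hnorm hdecay hN hN' hprob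
  calc _ ≤ 4 * PoissonHam.energyScale d C ϱ p L *
        (PoissonHam.formConst u * (PoissonHam.deltaScale d ϱ p L ^ (d + 1)) ^ 2) :=
        mul_le_mul_of_nonneg_left (PoissonHam.formConst_mul_ge u hδ) (by positivity)
    _ = 1 := by
        rw [hE, hC]
        field_simp
    _ ≤ 1 := le_rfl
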